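/- Let $P$ be a simple polygon in the Euclidean plane with vertices $v_1,\dots,v_n$ in cyclic order, regarded as a closed region (the polygonal curve together with its interior); three consecutive vertices are allowed to be collinear. A vertex $v_i$ is \emph{reflex} if the interior angle of $P$ at $v_i$ is greater than $\pi$. The \emph{star region} $S_i^*$ of a reflex vertex $v_i$ is the set of all points $x\in P$ such that the segment $[v_i,x]$ is contained in $P$ and $x$ lies in the closed cone $\{v_i-s(v_{i-1}-v_i)-t(v_{i+1}-v_i): s,t\ge 0\}$ bounded by the extensions, beyond $v_i$, of the two edges at $v_i$. If $P$ contains $2$, $3$, $4$ or $5$ pairwise disjoint star regions (of distinct reflex vertices), then $P$ has at least $6$, $7$, $9$ or $10$ edges, respectively. Consequently, a simple polygon with $6$, $7$ or $8$ edges contains at most $2$, $3$ or $3$ pairwise disjoint star regions, respectively. -/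

import Mathlib

/-- The Euclidean plane. -/
abbrev Plane : Type := EuclideanSpace ℝ (Fin 2)

namespace Polygon

/-- The polygon is simple: it has at least three edges, consecutive edges meet only in their common
vertex, and non-consecutive edges are disjoint. Three consecutive vertices may be collinear. -/
structure IsSimple {n : ℕ} (P : Polygon Plane n) : Prop where
  three_le : 3 ≤ n
  nondegenerate : P.HasNondegenerateEdges
  consecutive : ∀ i : Fin n,
    P.edgeSet ℝ i ∩ P.edgeSet ℝ (finRotate n i) = {P (finRotate n i)}
  nonconsecutive : ∀ i j : Fin n, i ≠ j → j ≠ finRotate n i → i ≠ finRotate n j →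
    Disjoint (P.edgeSet ℝ i) (P.edgeSet ℝ j)

/-- The closed planar region enclosed by the polygon: the boundary together with the bounded
connected components of its complement. -/
def region {n : ℕ} (P : Polygon Plane n) : Set Plane :=
  P.boundary ℝ ∪
    {x | x ∉ P.boundary ℝ ∧ Bornology.IsBounded (connectedComponentIn (P.boundary ℝ)ᶜ x)}

/-- The edge vector from vertex `i` to the next vertex. -/
noncomputable def toNext {n : ℕ} (P : Polygon Plane n) (i : Fin n) : Plane :=
  P (finRotate n i) - P i

/-- The edge vector from vertex `i` to the previous vertex. -/
noncomputable def toPrev {n : ℕ} (P : Polygon Plane n) (i : Fin n) : Plane :=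
  P ((finRotate n).symm i) - P i

/-- Vertex `i` is reflex, i.e. its interior angle exceeds `π`: the two edges at `i` are not
collinear, and the open sector of angle less than `π` between them lies, near the vertex, outside
the region (so the interior angle is `2 * π` minus the angle of that sector). -/
def IsReflex {n : ℕ} (P : Polygon Plane n) (i : Fin n) : Prop :=
  LinearIndependent ℝ ![P.toPrev i, P.toNext i] ∧
    ∃ ε : ℝ, 0 < ε ∧ ∀ s t : ℝ, 0 < s → s < ε → 0 < t → t < ε →
      P i + s • P.toPrev i + t • P.toNext i ∉ P.region

/-- The star region of vertex `i`: the points `x` of the region that are visible from the vertex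
and lie in the closed cone across the vertex, bounded by the extensions beyond the vertex of its two
edges. -/
def starRegion {n : ℕ} (P : Polygon Plane n) (i : Fin n) : Set Plane :=
  {x | x ∈ P.region ∧ segment ℝ (P i) x ⊆ P.region ∧
    ∃ s t : ℝ, 0 ≤ s ∧ 0 ≤ t ∧ x = P i - s • P.toPrev i - t • P.toNext i}

/-- `S` is a set of reflex vertices whose star regions are pairwise disjoint. -/
def HasDisjointStarRegions {n : ℕ} (P : Polygon Plane n) (S : Finset (Fin n)) : Prop :=
  (∀ i ∈ S, P.IsReflex i) ∧
    ∀ i ∈ S, ∀ j ∈ S, i ≠ j → P.starRegion i ∩ P.starRegion j = ∅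

/-- The polygon contains `k` pairwise disjoint star regions. -/
def ContainsDisjointStarRegions {n : ℕ} (P : Polygon Plane n) (k : ℕ) : Prop :=
  ∃ S : Finset (Fin n), S.card = k ∧ P.HasDisjointStarRegions S

end Polygon

/-! Call a point of a set flat if the set contains a segment around it. A non-flat point of the
region is a vertex and is not reflex, so `k` reflex vertices together with `m` non-flat points give
`k + m ≤ n` (`card_add_le`). It remains to find four non-flat points when there are at least two
disjoint star regions, and five when there are at least four.

Such points are found behind chords. A chord from `v i` in a direction of its cone lies in the star
region of `v i`; let `K i j` be the part of the region that it cuts off from `v j`, chord included.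
The direction can be chosen so that `K i j` is flat at `v i` (`exists_chord`). If neither extension
of an edge at `v i` will do, then the chord along one extension leaves its own edge joined to `v j`,
and so does the chord along the other. Being joined is an open condition on the direction, and a
chord never leaves both edges joined to `v j` (`not_joinedIn`, by a winding argument). Connectedness
of the interval of directions then gives a chord that cuts both edges off from `v j`. Hence the far
end `q` of the chord is the only point of the chord where `K i j` may fail to be flat. A point of a
compact set farthest from a given centre is not flat, and the centre can be chosen so that two
prescribed points are avoided (`exists_not_isFlatAt`); so `K i j` contains two non-flat points of
the region (`exists_two`).

Since the star regions are disjoint, the parts are nested or disjoint according to the apices they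
contain. `K i j` and `K j i` are disjoint, which gives four points. Every part contains a leaf, a
part with a single apex. With at least four stars, either there are leaves at three apices, or two
inner stars face each other and the piece between their chords holds a fifth point
(`exists_between`). -/

open Set Filter Topology

/-! ### Subtended angles: continuity, jump across the segment, decay at infinity -/

/-- The identification of the Euclidean plane with the complex numbers. -/
noncomputable def toComplex : Plane ≃ₗᵢ[ℝ] ℂ := Complex.orthonormalBasisOneI.repr.symm

/-- The signed angle in `(-π, π]` under which the segment from `a` to `b` is seen from `x`. -/
noncomputable def subtendedAngle (a b x : Plane) : ℝ :=
  Complex.arg ((toComplex b - toComplex x) / (toComplex a - toComplex x))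

/-- Modulo `2π` the angle is a difference of arguments, so sums along closed loops telescope to
zero. -/
theorem subtendedAngle_coe {a b x : Plane} (ha : x ≠ a) (hb : x ≠ b) :
    (subtendedAngle a b x : Real.Angle) =
      (Complex.arg (toComplex b - toComplex x) : Real.Angle) -
        Complex.arg (toComplex a - toComplex x) :=
  Complex.arg_div_coe_angle (sub_ne_zero.2 fun h => hb (toComplex.injective h).symm)
    (sub_ne_zero.2 fun h => ha (toComplex.injective h).symm)

/-- The quotient meets the branch cut of `Complex.arg`, the nonpositive reals, only when `x` lies on
the segment. -/
theorem continuousAt_subtendedAngle {a b x : Plane} (h : x ∉ segment ℝ a b) :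
    ContinuousAt (subtendedAngle a b) x := by
  have ha : toComplex a - toComplex x ≠ 0 := sub_ne_zero.2 fun h' =>
    h (toComplex.injective h' ▸ left_mem_segment ℝ _ _)
  have hs : (toComplex b - toComplex x) / (toComplex a - toComplex x) ∈ Complex.slitPlane := by
    rw [Complex.mem_slitPlane_iff_not_le_zero]
    intro hle
    apply h
    rw [Complex.le_def] at hle
    set g := (toComplex b - toComplex x) / (toComplex a - toComplex x) with hg
    have hgr : g = ((g.re : ℝ) : ℂ) := Complex.ext (by simp) (by simpa using hle.2)
    have hre : g.re ≤ 0 := by simpa using hle.1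
    have hmul : toComplex b - toComplex x = g * (toComplex a - toComplex x) := by
      rw [hg, div_mul_cancel₀ _ ha]
    have hvec : b - x = g.re • (a - x) := by
      apply toComplex.injective
      rw [map_sub, map_smul, map_sub, hmul, Complex.real_smul, ← hgr]
    have h1 : 0 < 1 - g.re := by linarith
    refine ⟨-g.re / (1 - g.re), 1 / (1 - g.re), by apply div_nonneg <;> linarith, by positivity,
      by field_simp; ring, ?_⟩
    have hb : b = x + g.re • (a - x) := by rw [← hvec]; abel
    rw [hb]
    ext k
    simp
    field_simp
    ring
  unfold subtendedAngle
  refine ContinuousAt.comp (f := fun x => (toComplex b - toComplex x) / (toComplex a - toComplex x))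
    (Complex.continuousAt_arg hs) ?_
  have hc : Continuous toComplex := toComplex.continuous
  exact (continuousAt_const.sub hc.continuousAt).div (continuousAt_const.sub hc.continuousAt) ha

theorem toComplex_div_im_ne_zero {c d : Plane} (h : LinearIndependent ℝ ![c, d]) :
    (toComplex c / toComplex d).im ≠ 0 := by
  intro him
  have hd : toComplex d ≠ 0 := by
    have := h.ne_zero 1
    simpa using this
  set g := toComplex c / toComplex d with hg
  have hgr : g = ((g.re : ℝ) : ℂ) := Complex.ext (by simp) (by simpa using him)
  have hvec : c = g.re • d := by
    apply toComplex.injective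
    rw [map_smul, Complex.real_smul, ← hgr, hg, div_mul_cancel₀ _ hd]
  rw [LinearIndependent.pair_iff] at h
  have := h 1 (-g.re) (by nth_rewrite 1 [hvec]; simp)
  simp at this

/-- At the point with parameter `m` the quotient is the negative real `-(1 - m) / m`. On the two
sides of the segment its imaginary part has opposite signs, whence the limits `π` and `-π`. -/
theorem tendsto_subtendedAngle_of_im_pos {a b c : Plane} {m : ℝ} (hm0 : 0 < m) (hm1 : m < 1)
    (hab : a ≠ b) (hc : 0 < (toComplex c / toComplex (b - a)).im) :
    Tendsto (fun t : ℝ => subtendedAngle a b (a + m • (b - a) + t • c)) (𝓝[>] 0) (𝓝 Real.pi) ∧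
    Tendsto (fun t : ℝ => subtendedAngle a b (a + m • (b - a) - t • c)) (𝓝[>] 0) (𝓝 (-Real.pi)) := by
  set w := toComplex (b - a) with hw
  have hw0 : w ≠ 0 := by simpa [hw, sub_eq_zero] using hab.symm
  set k := toComplex c / w with hk
  have hck : toComplex c = k * w := by rw [hk, div_mul_cancel₀ _ hw0]
  set g : ℝ → ℂ := fun t => ((1 - m : ℝ) - t * k) / (-(m : ℝ) - t * k) with hg
  have hden : ∀ t : ℝ, (-(m : ℝ) - t * k : ℂ) ≠ 0 := by
    intro t h0
    have h1 := congrArg Complex.im h0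
    have h2 := congrArg Complex.re h0
    simp at h1 h2
    rcases h1 with h1 | h1
    · subst h1; simp at h2; linarith
    · linarith
  have hsub : ∀ t : ℝ, subtendedAngle a b (a + m • (b - a) + t • c) = (g t).arg := by
    intro t
    unfold subtendedAngle
    congr 1
    have h2 : toComplex b = toComplex a + w := by simp [hw]
    have hx : toComplex (a + m • (b - a) + t • c) = toComplex a + m * w + t * (k * w) := by
      rw [map_add, map_add, map_smul, map_smul, Complex.real_smul, Complex.real_smul, hck]
    rw [hx, h2]
    have e1 : toComplex a + w - (toComplex a + m * w + t * (k * w)) = ((1 - m : ℝ) - t * k) * w := by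
      push_cast; ring
    have e2 : toComplex a - (toComplex a + m * w + t * (k * w)) = (-(m : ℝ) - t * k) * w := by
      ring
    rw [e1, e2, mul_div_mul_right _ _ hw0]
  have hsub' : ∀ t : ℝ, subtendedAngle a b (a + m • (b - a) - t • c) = (g (-t)).arg := by
    intro t
    rw [← hsub, neg_smul, sub_eq_add_neg]
  have him : ∀ t : ℝ, (g t).im = t * k.im / Complex.normSq (-(m : ℝ) - t * k) := by
    intro t
    rw [hg]
    simp only [Complex.div_im]
    rw [← sub_div]
    congr 1
    simp
    ring
  have hg0 : g 0 = ((-((1 - m) / m) : ℝ) : ℂ) := by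
    simp only [hg]; simp [div_neg]
  have hre : (g 0).re < 0 := by
    rw [hg0, Complex.ofReal_re, neg_lt_zero]; apply div_pos <;> linarith
  have him0 : (g 0).im = 0 := by rw [hg0, Complex.ofReal_im]
  have hgc : Continuous g := by
    refine Continuous.div ?_ ?_ hden <;> fun_prop
  have hn : ∀ t : ℝ, 0 < Complex.normSq (-(m : ℝ) - t * k) := fun t => Complex.normSq_pos.2 (hden t)
  constructor
  · simp only [hsub]
    refine (Complex.tendsto_arg_nhdsWithin_im_nonneg_of_re_neg_of_im_zero hre him0).comp ?_
    refine tendsto_nhdsWithin_iff.2 ⟨hgc.continuousAt.tendsto.mono_left nhdsWithin_le_nhds, ?_⟩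
    filter_upwards [self_mem_nhdsWithin] with t ht
    have ht : 0 < t := ht
    change 0 ≤ (g t).im
    rw [him]
    have := hn t
    positivity
  · simp only [hsub']
    refine (Complex.tendsto_arg_nhdsWithin_im_neg_of_re_neg_of_im_zero hre him0).comp ?_
    refine tendsto_nhdsWithin_iff.2 ⟨?_, ?_⟩
    · have : Tendsto (fun t : ℝ => g (-t)) (𝓝 0) (𝓝 (g (-0))) :=
        (hgc.comp continuous_neg).continuousAt.tendsto
      rw [neg_zero] at this
      exact this.mono_left nhdsWithin_le_nhds
    filter_upwards [self_mem_nhdsWithin] with t ht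
    have ht : 0 < t := ht
    change (g (-t)).im < 0
    rw [him]
    apply div_neg_of_neg_of_pos _ (hn _)
    nlinarith

/-- The angle under which a segment is seen jumps across the segment, and a summand that is
continuous there does not compensate for it. -/
theorem eventually_subtendedAngle_add_ne {a b c p : Plane} {G : Plane → ℝ}
    (hp : p ∈ openSegment ℝ a b) (hc : LinearIndependent ℝ ![c, b - a])
    (hG : Tendsto (fun t : ℝ => G (p + t • c)) (𝓝[>] 0) (𝓝 (G p)))
    (hG' : Tendsto (fun t : ℝ => G (p - t • c)) (𝓝[>] 0) (𝓝 (G p))) :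
    ∀ᶠ t : ℝ in 𝓝[>] 0, subtendedAngle a b (p + t • c) + G (p + t • c) ≠
      subtendedAngle a b (p - t • c) + G (p - t • c) := by
  have hab : a ≠ b := by
    rintro rfl
    exact hc.ne_zero 1 (by simp)
  rw [openSegment_eq_image'] at hp
  obtain ⟨m, ⟨hm0, hm1⟩, rfl⟩ := hp
  have him := toComplex_div_im_ne_zero hc
  simp only at hG hG' ⊢
  rcases him.lt_or_gt with h | h
  · have h' : 0 < (toComplex (-c) / toComplex (b - a)).im := by
      rw [map_neg, neg_div]; simpa using h
    obtain ⟨h1, h2⟩ := tendsto_subtendedAngle_of_im_pos hm0 hm1 hab h'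
    simp only [smul_neg, sub_neg_eq_add, ← sub_eq_add_neg] at h1 h2
    have h3 := ((h1.add hG').sub (h2.add hG)).eventually_ne
      (b₂ := (0 : ℝ))
      (by have := Real.pi_pos; intro h0; linarith)
    filter_upwards [h3] with t ht heq
    exact ht (by rw [heq]; ring)
  · obtain ⟨h1, h2⟩ := tendsto_subtendedAngle_of_im_pos hm0 hm1 hab h
    have h3 := ((h1.add hG).sub (h2.add hG')).eventually_ne
      (b₂ := (0 : ℝ))
      (by have := Real.pi_pos; intro h0; linarith)
    filter_upwards [h3] with t ht heq
    exact ht (by rw [heq]; ring)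

theorem tendsto_subtendedAngle_cobounded (a b : Plane) :
    Tendsto (subtendedAngle a b) (Bornology.cobounded Plane) (𝓝 0) := by
  have hnorm : Tendsto (fun x => ‖toComplex a - toComplex x‖) (Bornology.cobounded Plane) atTop := by
    refine tendsto_atTop_mono (fun x => ?_)
      (tendsto_atTop_add_const_right _ (-‖a‖) tendsto_norm_cobounded_atTop)
    rw [← map_sub, toComplex.norm_map, ← sub_eq_add_neg, norm_sub_rev]
    exact norm_sub_norm_le _ _
  have hinv : Tendsto (fun x => (toComplex a - toComplex x)⁻¹) (Bornology.cobounded Plane) (𝓝 0) :=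
    tendsto_inv₀_cobounded.comp (tendsto_norm_atTop_iff_cobounded.1 hnorm)
  have h1 : Tendsto (fun x => 1 + (toComplex b - toComplex a) * (toComplex a - toComplex x)⁻¹)
      (Bornology.cobounded Plane) (𝓝 1) := by
    simpa using tendsto_const_nhds.add (tendsto_const_nhds.mul hinv)
  have h2 : Tendsto (fun x => (toComplex b - toComplex x) / (toComplex a - toComplex x))
      (Bornology.cobounded Plane) (𝓝 1) := by
    refine h1.congr' ?_
    filter_upwards [hnorm.eventually_gt_atTop 0] with x hx
    have := norm_pos_iff.1 hx
    field_simp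
    ring
  have h3 := (Complex.continuousAt_arg Complex.one_mem_slitPlane).tendsto.comp h2
  rwa [Complex.arg_one] at h3

/-- A continuous function with values in `2πℤ` is constant on preconnected sets. -/
theorem IsPreconnected.eq_of_coe_angle_eq_zero {S : Set Plane} (hS : IsPreconnected S)
    {W : Plane → ℝ} (hW : ContinuousOn W S) (h0 : ∀ x ∈ S, (W x : Real.Angle) = 0)
    {x y : Plane} (hx : x ∈ S) (hy : y ∈ S) : W x = W y := by
  have hI := (hS.image W hW).ordConnected
  by_contra hne
  wlog hlt : W x < W y generalizing x y
  · exact this hy hx (Ne.symm hne) (lt_of_le_of_ne (not_lt.1 hlt) (Ne.symm hne))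
  obtain ⟨k, hk⟩ := Real.Angle.coe_eq_zero_iff.1 (h0 x hx)
  obtain ⟨l, hl⟩ := Real.Angle.coe_eq_zero_iff.1 (h0 y hy)
  have hpi := Real.pi_pos
  simp only [zsmul_eq_mul] at hk hl
  have hkl : k < l := by
    by_contra! h
    have : (l : ℝ) ≤ k := by exact_mod_cast h
    nlinarith
  have hkl' : (k : ℝ) + 1 ≤ l := by exact_mod_cast hkl
  -- The intermediate value `W x + π` would be attained, but it is not a multiple of `2π`.
  have hm : W x + Real.pi ∈ W '' S := hI.out ⟨x, hx, rfl⟩ ⟨y, hy, rfl⟩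
    ⟨by linarith, by nlinarith⟩
  obtain ⟨z, hz, hzW⟩ := hm
  obtain ⟨j, hj⟩ := Real.Angle.coe_eq_zero_iff.1 (h0 z hz)
  simp only [zsmul_eq_mul] at hj
  have : (2 * j : ℝ) = 2 * k + 1 := by
    have : (2 * j : ℝ) * Real.pi = (2 * k + 1) * Real.pi := by nlinarith
    exact mul_right_cancel₀ hpi.ne' this
  have : (2 * j : ℤ) = 2 * k + 1 := by exact_mod_cast this
  omega

/-! ### Flat points and farthest points -/

/-- `K` contains a segment around `x`. -/
def IsFlatAt (K : Set Plane) (x : Plane) : Prop :=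
  ∃ w : Plane, w ≠ 0 ∧ ∀ᶠ t : ℝ in 𝓝 0, x + t • w ∈ K

theorem IsFlatAt.congr {K L : Set Plane} {x : Plane} (h : IsFlatAt K x)
    (hKL : ∀ᶠ y in 𝓝 x, y ∈ K → y ∈ L) : IsFlatAt L x := by
  obtain ⟨w, hw, h⟩ := h
  refine ⟨w, hw, ?_⟩
  have hc : Tendsto (fun t : ℝ => x + t • w) (𝓝 0) (𝓝 x) := by
    have : ContinuousAt (fun t : ℝ => x + t • w) 0 := by fun_prop
    simpa [ContinuousAt] using this
  filter_upwards [h, hc.eventually hKL] with t h1 h2 using h2 h1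

theorem isFlatAt_of_mem_nhds {K : Set Plane} {x : Plane} (h : K ∈ 𝓝 x) : IsFlatAt K x := by
  refine IsFlatAt.congr (K := univ) ⟨EuclideanSpace.single 0 1, ?_, by simp⟩ ?_
  · intro h0
    have := congrArg (fun v : Plane => v 0) h0
    simp at this
  · filter_upwards [h] with y hy _ using hy

theorem isFlatAt_of_mem_openSegment {K : Set Plane} {a b x : Plane} (hab : a ≠ b)
    (hK : segment ℝ a b ⊆ K) (hx : x ∈ openSegment ℝ a b) : IsFlatAt K x := by
  rw [openSegment_eq_image'] at hx
  obtain ⟨m, ⟨hm0, hm1⟩, rfl⟩ := hx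
  refine ⟨b - a, sub_ne_zero.2 hab.symm, ?_⟩
  have h1 : ∀ᶠ t : ℝ in 𝓝 0, 0 < m + t := by
    have : ContinuousAt (fun t : ℝ => m + t) 0 := by fun_prop
    exact this.eventually_const_lt (by simpa)
  have h2 : ∀ᶠ t : ℝ in 𝓝 0, m + t < 1 := by
    have : ContinuousAt (fun t : ℝ => m + t) 0 := by fun_prop
    exact this.eventually_lt_const (by simpa)
  filter_upwards [h1, h2] with t h1 h2
  apply hK
  rw [segment_eq_image']
  exact ⟨m + t, ⟨h1.le, h2.le⟩, by simp only [add_smul]; abel⟩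

theorem exists_ne_zero_inner_eq_zero (v : Plane) : ∃ u : Plane, u ≠ 0 ∧ inner ℝ v u = 0 := by
  by_cases hv : v = 0
  · exact ⟨EuclideanSpace.single 0 1, fun h0 => by
      have := congrArg (fun v : Plane => v 0) h0
      simp at this, by simp [hv]⟩
  · refine ⟨!₂[-(v 1), v 0], fun h0 => hv ?_, ?_⟩
    · have h1 := congrArg (fun v : Plane => v 0) h0
      have h2 := congrArg (fun v : Plane => v 1) h0
      simp at h1 h2
      ext i
      fin_cases i <;> simp [h1, h2]
    · simp [PiLp.inner_apply, Fin.sum_univ_two]; ring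

/-- A compact set with interior points has a point around which it contains no segment, different
from any two given points. -/
theorem exists_not_isFlatAt {K : Set Plane} (hK : IsCompact K) (hi : (interior K).Nonempty)
    (p q : Plane) : ∃ x ∈ K, ¬ IsFlatAt K x ∧ x ≠ p ∧ x ≠ q := by
  obtain ⟨y, hy⟩ := hi
  obtain ⟨u, hu0, hu⟩ := exists_ne_zero_inner_eq_zero (p - q)
  set m : Plane := (1 / 2 : ℝ) • (p + q) with hm
  have hyK : y ∈ K := interior_subset hy
  -- a point of `K` on one side of the line through `p` and `q`
  have hx0 : ∃ u : Plane, inner ℝ (p - q) u = 0 ∧ ∃ x₀ ∈ K, 0 < inner ℝ (x₀ - m) u := by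
    have h1 : ∃ x₀ ∈ K, inner ℝ (x₀ - m) u ≠ 0 := by
      by_cases hym : inner ℝ (y - m) u = 0
      · have hc : Tendsto (fun t : ℝ => y + t • u) (𝓝[>] 0) (𝓝 y) := by
          have : ContinuousAt (fun t : ℝ => y + t • u) 0 := by fun_prop
          have h : Tendsto (fun t : ℝ => y + t • u) (𝓝 0) (𝓝 y) := by
            simpa [ContinuousAt] using this
          exact h.mono_left nhdsWithin_le_nhds
        obtain ⟨t, ht, ht0⟩ := ((hc.eventually (mem_interior_iff_mem_nhds.1 hy)).and
          self_mem_nhdsWithin).exists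
        have ht0 : 0 < t := ht0
        refine ⟨_, ht, ?_⟩
        rw [add_sub_right_comm, inner_add_left, hym, zero_add, real_inner_smul_left]
        exact mul_ne_zero ht0.ne' (by simpa using hu0)
      · exact ⟨y, hyK, hym⟩
    obtain ⟨x₀, hx₀, hne⟩ := h1
    rcases hne.lt_or_gt with h | h
    · exact ⟨-u, by simp [hu], x₀, hx₀, by simpa using h⟩
    · exact ⟨u, hu, x₀, hx₀, h⟩
  clear! u
  obtain ⟨u, hu, x₀, hx₀, hpos⟩ := hx0
  have hexp : ∀ (s : ℝ) (x : Plane), ‖x - (m - s • u)‖ ^ 2 =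
      ‖x - m‖ ^ 2 + 2 * s * inner ℝ (x - m) u + s ^ 2 * ‖u‖ ^ 2 := by
    intro s x
    rw [show x - (m - s • u) = (x - m) + s • u by abel, norm_add_sq_real, real_inner_smul_right,
      norm_smul, mul_pow, Real.norm_eq_abs, sq_abs]
    ring
  have hpm : p - m = (1 / 2 : ℝ) • (p - q) := by rw [hm]; module
  have hqm : q - m = (-(1 / 2) : ℝ) • (p - q) := by rw [hm]; module
  have hip : inner ℝ (p - m) u = 0 := by rw [hpm, real_inner_smul_left, hu, mul_zero]
  have hiq : inner ℝ (q - m) u = 0 := by rw [hqm, real_inner_smul_left, hu, mul_zero]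
  -- The centre `m - s • u` lies on the perpendicular bisector of `p` and `q`, away from `x₀`; this
  -- `s` is large enough for `x₀` to be farther from it than `p` and `q` are.
  set s : ℝ := (‖p - m‖ ^ 2 + ‖q - m‖ ^ 2 + 1) / inner ℝ (x₀ - m) u with hs
  have hs' : s * inner ℝ (x₀ - m) u = ‖p - m‖ ^ 2 + ‖q - m‖ ^ 2 + 1 := div_mul_cancel₀ _ hpos.ne'
  obtain ⟨x, hxK, hmax⟩ := hK.exists_isMaxOn ⟨y, hyK⟩
    (f := fun x => ‖x - (m - s • u)‖ ^ 2) (by fun_prop)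
  have hx0le := hmax hx₀
  simp only [mem_ofPred_eq] at hx0le
  rw [hexp s x₀] at hx0le
  refine ⟨x, hxK, ?_, ?_, ?_⟩
  -- On a segment around `x`, one of the points `x + t • w` and `x - t • w` would be farther from
  -- the centre than `x`.
  · rintro ⟨w, hw0, hw⟩
    have hw' : ∀ᶠ t : ℝ in 𝓝 0, x + (-t) • w ∈ K := by
      have : Tendsto (fun t : ℝ => -t) (𝓝 0) (𝓝 0) := by simpa using (continuous_neg (G := ℝ)).tendsto 0
      exact this.eventually hw
    obtain ⟨t, ⟨h1, h2⟩, ht0⟩ := (((hw.and hw').filter_mono nhdsWithin_le_nhds).and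
      (self_mem_nhdsWithin (a := (0 : ℝ)) (s := Ioi 0))).exists
    have ht0 : 0 < t := ht0
    have h1 := hmax h1
    have h2 := hmax h2
    simp only [mem_ofPred_eq] at h1 h2
    set z := x - (m - s • u) with hz
    rw [show x + t • w - (m - s • u) = z + t • w by rw [hz]; abel, norm_add_sq_real] at h1
    rw [show x + (-t) • w - (m - s • u) = z - t • w by rw [hz, neg_smul]; abel,
      norm_sub_sq_real] at h2
    have : 0 < ‖t • w‖ := norm_pos_iff.2 (smul_ne_zero ht0.ne' hw0)
    nlinarith
  · rintro rfl
    rw [hexp, hip] at hx0le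
    nlinarith [sq_nonneg ‖x₀ - m‖, sq_nonneg ‖x - m‖, sq_nonneg ‖q - m‖]
  · rintro rfl
    rw [hexp, hiq] at hx0le
    nlinarith [sq_nonneg ‖x₀ - m‖, sq_nonneg ‖x - m‖, sq_nonneg ‖p - m‖]

theorem joinedIn_of_segment_subset {F : Set Plane} {x y : Plane} (h : segment ℝ x y ⊆ F) :
    JoinedIn F x y := by
  refine JoinedIn.ofLine (f := AffineMap.lineMap x y) (by fun_prop) (by simp) (by simp) ?_
  rw [segment_eq_image_lineMap] at h
  exact h

/-- The exterior is the image of the punctured plane under pushing every point outwards by `r`. -/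
theorem isPreconnected_compl_closedBall (r : ℝ) (hr : 0 ≤ r) :
    IsPreconnected (Metric.closedBall (0 : Plane) r)ᶜ := by
  have hrank : 1 < Module.rank ℝ Plane := by
    rw [← Module.finrank_eq_rank]
    simp [Plane]
  have h := (isConnected_compl_singleton_of_one_lt_rank hrank (0 : Plane)).isPreconnected
  have him : (fun x : Plane => (1 + r / ‖x‖) • x) '' {0}ᶜ = (Metric.closedBall (0 : Plane) r)ᶜ := by
    ext y
    simp only [mem_image, mem_compl_iff, mem_singleton_iff, Metric.mem_closedBall, dist_zero_right,
      not_le]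
    constructor
    · rintro ⟨x, hx, rfl⟩
      have hx := norm_pos_iff.2 hx
      rw [norm_smul, Real.norm_eq_abs, abs_of_pos (by positivity)]
      field_simp
      linarith
    · intro hy
      have hy0 : 0 < ‖y‖ := by linarith
      have hyr : 0 < ‖y‖ - r := by linarith
      refine ⟨((‖y‖ - r) / ‖y‖) • y, smul_ne_zero (by positivity) (norm_pos_iff.1 hy0), ?_⟩
      rw [smul_smul, norm_smul, Real.norm_eq_abs, abs_of_pos (by positivity)]
      have : (1 + r / ((‖y‖ - r) / ‖y‖ * ‖y‖)) * ((‖y‖ - r) / ‖y‖) = 1 := by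
        field_simp; ring
      rw [this, one_smul]
  rw [← him]
  refine h.image _ ?_
  intro x hx
  have : ‖x‖ ≠ 0 := norm_ne_zero_iff.2 hx
  exact ContinuousAt.continuousWithinAt (by fun_prop (disch := assumption))

/-! ### Topology of the region: compact, path-connected, locally star-shaped, with connected
complement -/

namespace Polygon

variable {n : ℕ} (P : Polygon Plane n)

theorem edgeSet_eq_segment (i : Fin n) : P.edgeSet ℝ i = segment ℝ (P i) (P (finRotate n i)) :=
  affineSegment_eq_segment _ _ _

theorem isCompact_boundary : IsCompact (P.boundary ℝ) := by
  refine isCompact_iUnion fun i => ?_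
  rw [edgeSet_eq_segment, segment_eq_image_lineMap]
  exact isCompact_Icc.image (by fun_prop)

theorem exists_radius : ∃ r : ℝ, 0 ≤ r ∧ P.boundary ℝ ⊆ Metric.closedBall 0 r := by
  obtain ⟨r, hr⟩ := P.isCompact_boundary.isBounded.subset_closedBall 0
  exact ⟨max r 0, le_max_right _ _, hr.trans (Metric.closedBall_subset_closedBall (le_max_left _ _))⟩

theorem isOpen_component (x : Plane) : IsOpen (connectedComponentIn (P.boundary ℝ)ᶜ x) :=
  P.isCompact_boundary.isClosed.isOpen_compl.connectedComponentIn

theorem mem_region_of_mem_boundary {x : Plane} (h : x ∈ P.boundary ℝ) : x ∈ P.region := Or.inl h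

/-- Preconnected sets off the boundary lie inside or outside the region. -/
theorem mem_region_of_isPreconnected {S : Set Plane} (hS : IsPreconnected S)
    (hb : S ⊆ (P.boundary ℝ)ᶜ) {x y : Plane} (hx : x ∈ S) (hy : y ∈ S) (hR : x ∈ P.region) :
    y ∈ P.region := by
  rcases hR with h | ⟨-, h⟩
  · exact absurd h (hb hx)
  · refine Or.inr ⟨hb hy, ?_⟩
    rwa [← connectedComponentIn_eq (hS.subset_connectedComponentIn hx hb hy)]

theorem region_mem_nhds {x : Plane} (hx : x ∈ P.region) (hb : x ∉ P.boundary ℝ) :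
    P.region ∈ 𝓝 x := by
  refine Filter.mem_of_superset ((P.isOpen_component x).mem_nhds (mem_connectedComponentIn hb)) ?_
  intro y hy
  exact P.mem_region_of_isPreconnected isPreconnected_connectedComponentIn
    (connectedComponentIn_subset _ _) (mem_connectedComponentIn hb) hy hx

theorem component_subset_compl_region {x : Plane} (hx : x ∉ P.region) :
    connectedComponentIn (P.boundary ℝ)ᶜ x ⊆ P.regionᶜ := by
  intro y hy hyR
  have hb : x ∉ P.boundary ℝ := fun h => hx (Or.inl h)
  exact hx (P.mem_region_of_isPreconnected isPreconnected_connectedComponentIn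
    (connectedComponentIn_subset _ _) hy (mem_connectedComponentIn hb) hyR)

theorem isOpen_compl_region : IsOpen P.regionᶜ := by
  rw [isOpen_iff_mem_nhds]
  intro x hx
  have hb : x ∉ P.boundary ℝ := fun h => hx (Or.inl h)
  exact Filter.mem_of_superset ((P.isOpen_component x).mem_nhds (mem_connectedComponentIn hb))
    (P.component_subset_compl_region hx)

theorem not_isBounded_component {x : Plane} (hx : x ∉ P.region) :
    ¬ Bornology.IsBounded (connectedComponentIn (P.boundary ℝ)ᶜ x) :=
  fun h => hx (Or.inr ⟨fun h => hx (Or.inl h), h⟩)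

theorem compl_closedBall_subset {r : ℝ} (hr : 0 ≤ r) (hb : P.boundary ℝ ⊆ Metric.closedBall 0 r) :
    (Metric.closedBall 0 r)ᶜ ⊆ P.regionᶜ := by
  intro x hx hxR
  rcases hxR with h | ⟨hxb, hB⟩
  · exact hx (hb h)
  · have hsub := (isPreconnected_compl_closedBall r hr).subset_connectedComponentIn hx
      (compl_subset_compl.2 hb)
    have h2 : Bornology.IsBounded (univ : Set Plane) := by
      rw [← union_compl_self (Metric.closedBall (0 : Plane) r)]
      exact Metric.isBounded_closedBall.union (hB.subset hsub)
    exact NormedSpace.unbounded_univ ℝ Plane h2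

theorem isCompact_region : IsCompact P.region := by
  obtain ⟨r, hr, hb⟩ := P.exists_radius
  exact (isCompact_closedBall (0 : Plane) r).of_isClosed_subset
    (isOpen_compl_iff.1 P.isOpen_compl_region) (compl_subset_compl.1 (P.compl_closedBall_subset hr hb))

/-- A point outside lies in an unbounded component of the complement of the boundary. This component
meets the exterior of a large disc, which is connected and lies outside the region. -/
theorem isPreconnected_compl_region : IsPreconnected P.regionᶜ := by
  obtain ⟨r, hr, hb⟩ := P.exists_radius
  have hO := isPreconnected_compl_closedBall r hr
  have key : ∀ x ∈ P.regionᶜ, ∃ t ⊆ P.regionᶜ, x ∈ t ∧ (Metric.closedBall 0 r)ᶜ ⊆ t ∧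
      IsPreconnected t := by
    intro x hx
    have hub := P.not_isBounded_component hx
    have hxb : x ∉ P.boundary ℝ := fun h => hx (Or.inl h)
    obtain ⟨y, hyC, hyr⟩ := not_subset.1 fun h => hub (Metric.isBounded_closedBall.subset h)
    exact ⟨connectedComponentIn (P.boundary ℝ)ᶜ x ∪ (Metric.closedBall 0 r)ᶜ,
      union_subset (P.component_subset_compl_region hx) (P.compl_closedBall_subset hr hb),
      Or.inl (mem_connectedComponentIn hxb), subset_union_right,
      isPreconnected_connectedComponentIn.union y hyC hyr hO⟩
  obtain ⟨z, hz⟩ : ((Metric.closedBall (0 : Plane) r)ᶜ).Nonempty := by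
    by_contra! h
    have : (Metric.closedBall (0 : Plane) r) = univ := by rw [← compl_empty_iff, h]
    exact NormedSpace.unbounded_univ ℝ Plane (this ▸ Metric.isBounded_closedBall)
  refine isPreconnected_of_forall_pair fun x hx y hy => ?_
  obtain ⟨s, hs, hxs, hOs, hsc⟩ := key x hx
  obtain ⟨t, ht, hyt, hOt, htc⟩ := key y hy
  exact ⟨s ∪ t, union_subset hs ht, Or.inl hxs, Or.inr hyt, hsc.union z (hOs hz) (hOt hz) htc⟩

/-- Near any point, an edge is a cone with apex that point, or absent. -/
theorem exists_ball_edge (x a b : Plane) : ∃ r > 0, ∀ y ∈ Metric.ball x r,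
    (y ∈ segment ℝ a b → x ∈ segment ℝ a b) ∧ ∀ s : ℝ, 0 < s →
    s ≤ 1 → (x + s • (y - x) ∈ segment ℝ a b → y ∈ segment ℝ a b) := by
  by_cases hx : x ∈ segment ℝ a b
  · have hx' := hx
    rw [segment_eq_image'] at hx
    obtain ⟨m, ⟨hm0, hm1⟩, rfl⟩ := hx
    by_cases hab : a = b
    · subst hab
      refine ⟨1, one_pos, fun y _ => ⟨fun _ => hx', fun s hs _ h => ?_⟩⟩
      simp only [segment_same, mem_singleton_iff, sub_self, smul_zero, add_zero] at h ⊢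
      have h : s • (y - a) = 0 := by simpa using h
      rw [smul_eq_zero, sub_eq_zero] at h
      exact h.resolve_left hs.ne'
    have hn : 0 < ‖b - a‖ := norm_pos_iff.2 (sub_ne_zero.2 (Ne.symm hab))
    -- In the parameter of the edge, `e` is at most the distance to each endpoint other than `x`. An
    -- endpoint equal to `x` gives no condition: there the sign of `k` is known from `l`.
    obtain ⟨e, he, he0, he1⟩ : ∃ e > 0, (m = 0 ∨ e ≤ m) ∧ (m = 1 ∨ e ≤ 1 - m) := by
      rcases hm0.eq_or_lt with rfl | h0
      · exact ⟨1, one_pos, Or.inl rfl, Or.inr (by norm_num)⟩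
      rcases hm1.eq_or_lt with rfl | h1
      · exact ⟨1, one_pos, Or.inr le_rfl, Or.inl rfl⟩
      exact ⟨min m (1 - m), lt_min h0 (by linarith), Or.inr (min_le_left _ _),
        Or.inr (min_le_right _ _)⟩
    refine ⟨e * ‖b - a‖, by positivity, fun y hy => ⟨fun _ => hx', fun s hs hs1 h => ?_⟩⟩
    rw [segment_eq_image'] at h ⊢
    obtain ⟨l, ⟨hl0, hl1⟩, hl⟩ := h
    simp only at hl
    set k := (l - m) / s with hk
    have hks : s * k = l - m := mul_div_cancel₀ _ hs.ne'
    have hyx : y - (a + m • (b - a)) = k • (b - a) := by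
      have h1 : s • (y - (a + m • (b - a))) = s • (k • (b - a)) := by
        rw [smul_smul, hks, sub_smul, ← sub_eq_zero]
        rw [← sub_eq_zero] at hl
        rw [← neg_eq_zero, ← hl]
        module
      exact smul_right_injective _ hs.ne' h1
    have hkn : |k| < e := by
      rw [Metric.mem_ball, dist_eq_norm, hyx, norm_smul, Real.norm_eq_abs] at hy
      exact lt_of_mul_lt_mul_right hy hn.le
    rw [abs_lt] at hkn
    refine ⟨m + k, ⟨?_, ?_⟩, ?_⟩
    · rcases he0 with rfl | h0
      · have : 0 ≤ k := by rw [hk]; apply div_nonneg <;> linarith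
        linarith
      · linarith
    · rcases he1 with rfl | h0
      · have : k ≤ 0 := by rw [hk]; apply div_nonpos_of_nonpos_of_nonneg <;> linarith
        linarith
      · linarith
    · simp only
      rw [add_smul, ← hyx]; abel
  · have hcl : IsClosed (segment ℝ a b) := by
      rw [segment_eq_image_lineMap]
      exact (isCompact_Icc.image (by fun_prop)).isClosed
    obtain ⟨r, hr, hsub⟩ := Metric.mem_nhds_iff.1 (hcl.isOpen_compl.mem_nhds hx)
    refine ⟨r, hr, fun y hy => ⟨fun h => absurd h (hsub hy), fun s hs hs1 h => absurd h (hsub ?_)⟩⟩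
    exact (convex_ball x r).add_smul_sub_mem (Metric.mem_ball_self hr) hy ⟨hs.le, hs1⟩

theorem exists_ball_boundary (x : Plane) : ∃ r > 0, ∀ y ∈ Metric.ball x r,
    (y ∈ P.boundary ℝ → segment ℝ x y ⊆ P.boundary ℝ) ∧ ∀ s : ℝ, 0 < s →
    s ≤ 1 → (x + s • (y - x) ∈ P.boundary ℝ → y ∈ P.boundary ℝ) := by
  have h : ∀ᶠ r : ℝ in 𝓝[>] 0, ∀ i : Fin n, ∀ y ∈ Metric.ball x r,
    (y ∈ P.edgeSet ℝ i → x ∈ P.edgeSet ℝ i) ∧ ∀ s : ℝ, 0 < s →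
    s ≤ 1 → (x + s • (y - x) ∈ P.edgeSet ℝ i → y ∈ P.edgeSet ℝ i) := by
    rw [eventually_all]
    intro i
    obtain ⟨r, hr, h⟩ := exists_ball_edge x (P i) (P (finRotate n i))
    filter_upwards [Ioo_mem_nhdsGT hr] with r' hr' y hy
    rw [edgeSet_eq_segment]
    exact h y (Metric.ball_subset_ball hr'.2.le hy)
  obtain ⟨r, h, hr⟩ := (h.and self_mem_nhdsWithin).exists
  refine ⟨r, hr, fun y hy => ⟨fun hb => ?_, fun s hs hs1 hb => ?_⟩⟩
  · obtain ⟨i, hi⟩ := mem_iUnion.1 hb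
    have hx := (h i y hy).1 hi
    rw [edgeSet_eq_segment] at hx hi
    refine subset_trans ?_ (subset_iUnion _ i)
    rw [edgeSet_eq_segment]
    exact (convex_segment _ _).segment_subset hx hi
  · obtain ⟨i, hi⟩ := mem_iUnion.1 hb
    exact mem_iUnion.2 ⟨i, (h i y hy).2 s hs hs1 hi⟩

/-- The region is locally star-shaped. -/
theorem exists_ball_segment_subset {x : Plane} (hx : x ∈ P.region) : ∃ r > 0,
    ∀ y ∈ Metric.ball x r, y ∈ P.region → segment ℝ x y ⊆ P.region := by
  obtain ⟨r, hr, h⟩ := P.exists_ball_boundary x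
  refine ⟨r, hr, fun y hy hyR => ?_⟩
  by_cases hyb : y ∈ P.boundary ℝ
  · exact ((h y hy).1 hyb).trans fun _ => Or.inl
  · rw [segment_eq_image']
    rintro _ ⟨s, ⟨hs0, hs1⟩, rfl⟩
    rcases hs0.eq_or_lt with rfl | hs0
    · simpa using hx
    -- If `y` is off the boundary, then so is the segment without `x`, which therefore stays in the
    -- component of `y`.
    have hpre : IsPreconnected ((fun s : ℝ => x + s • (y - x)) '' Ioc 0 1) :=
      isPreconnected_Ioc.image _ (by fun_prop)
    refine P.mem_region_of_isPreconnected hpre ?_ ⟨1, ⟨one_pos, le_rfl⟩, by simp⟩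
      ⟨s, ⟨hs0, hs1⟩, rfl⟩ hyR
    rintro _ ⟨s, ⟨hs0, hs1⟩, rfl⟩ hb
    exact hyb ((h y hy).2 s hs0 hs1 hb)

theorem joinedIn_boundary_vertices (i j : Fin n) : JoinedIn (P.boundary ℝ) (P i) (P j) := by
  have hedge : ∀ i, JoinedIn (P.boundary ℝ) (P i) (P (finRotate n i)) := fun i =>
    joinedIn_of_segment_subset (by rw [← edgeSet_eq_segment]; exact subset_iUnion _ i)
  obtain ⟨m, rfl⟩ : ∃ m, n = m + 1 := ⟨n - 1, by have := i.2; omega⟩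
  have h0 : ∀ i, JoinedIn (P.boundary ℝ) (P 0) (P i) := by
    intro i
    induction i using Fin.induction with
    | zero => exact (hedge 0).trans (hedge 0).symm
    | succ i ih =>
      have := hedge i.castSucc
      rw [finRotate_apply, Fin.coeSucc_eq_succ] at this
      exact ih.trans this
  exact (h0 i).symm.trans (h0 j)

/-- A ray from `x` must leave the bounded region, so it hits the boundary; up to the first hit it
stays in one component. -/
theorem exists_joinedIn_boundary {x : Plane} (hx : x ∈ P.region) :
    ∃ y ∈ P.boundary ℝ, JoinedIn P.region x y := by
  by_cases hb : x ∈ P.boundary ℝ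
  · exact ⟨x, hb, JoinedIn.refl hx⟩
  set e : Plane := EuclideanSpace.single 0 1
  have he : ‖e‖ = 1 := by simp [e]
  set f : ℝ → Plane := fun t => x + t • e with hf
  have hfc : Continuous f := by fun_prop
  have hex : ∃ t, 0 ≤ t ∧ f t ∈ P.boundary ℝ := by
    by_contra! hno
    have hpre : IsPreconnected (f '' Ici 0) := isPreconnected_Ici.image _ hfc.continuousOn
    have hsub : f '' Ici 0 ⊆ P.region := by
      rintro _ ⟨t, ht, rfl⟩
      refine P.mem_region_of_isPreconnected hpre ?_ ⟨0, by simp, rfl⟩ ⟨t, ht, rfl⟩ (by simpa [hf])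
      rintro _ ⟨t, ht, rfl⟩
      exact hno t ht
    obtain ⟨r, hr⟩ := (P.isCompact_region.isBounded.subset hsub).subset_closedBall x
    have h1 : f (|r| + 1) ∈ Metric.closedBall x r := hr ⟨|r| + 1, by simp; positivity, rfl⟩
    rw [Metric.mem_closedBall, dist_eq_norm, hf] at h1
    simp only [add_sub_cancel_left, norm_smul, he, mul_one, Real.norm_eq_abs] at h1
    have := le_abs_self (|r| + 1)
    have := le_abs_self r
    linarith
  obtain ⟨t₁, ht₁, hb₁⟩ := hex
  have hc : IsCompact {t | t ∈ Icc 0 t₁ ∧ f t ∈ P.boundary ℝ} :=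
    isCompact_Icc.inter_right (P.isCompact_boundary.isClosed.preimage hfc)
  obtain ⟨t₀, ⟨⟨ht0, ht01⟩, hb0⟩, hmin⟩ := hc.exists_isLeast ⟨t₁, ⟨ht₁, le_rfl⟩, hb₁⟩
  refine ⟨f t₀, hb0, joinedIn_of_segment_subset ?_⟩
  rw [segment_eq_image']
  rintro _ ⟨s, ⟨hs0, hs1⟩, rfl⟩
  have hfs : x + s • (f t₀ - x) = f (s * t₀) := by simp [hf, smul_smul]
  simp only [hfs]
  rcases hs1.eq_or_lt with rfl | hs1
  · rw [one_mul]; exact Or.inl hb0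
  have ht0' : 0 < t₀ := by
    rcases ht0.eq_or_lt with h | h
    · rw [← h] at hb0; exact absurd hb0 (by simpa [hf] using hb)
    · exact h
  have hpre : IsPreconnected (f '' Ico 0 t₀) := isPreconnected_Ico.image _ hfc.continuousOn
  refine P.mem_region_of_isPreconnected hpre ?_ ⟨0, ⟨le_rfl, ht0'⟩, rfl⟩
    ⟨s * t₀, ⟨by positivity, by nlinarith⟩, rfl⟩ (by simpa [hf])
  rintro _ ⟨t, ⟨ht, ht'⟩, rfl⟩ hbt
  exact absurd (hmin ⟨⟨ht, by linarith⟩, hbt⟩) (not_le.2 ht')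

theorem joinedIn_region {x y : Plane} (hx : x ∈ P.region) (hy : y ∈ P.region) :
    JoinedIn P.region x y := by
  obtain ⟨x', hx', hxj⟩ := P.exists_joinedIn_boundary hx
  obtain ⟨y', hy', hyj⟩ := P.exists_joinedIn_boundary hy
  have key : ∀ z ∈ P.boundary ℝ, ∃ i, JoinedIn P.region z (P i) := by
    intro z hz
    obtain ⟨i, hi⟩ := mem_iUnion.1 hz
    refine ⟨i, joinedIn_of_segment_subset ?_⟩
    rw [edgeSet_eq_segment] at hi
    refine ((convex_segment _ _).segment_subset hi (left_mem_segment ℝ _ _)).trans ?_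
    rw [← edgeSet_eq_segment]
    exact (subset_iUnion _ i).trans fun _ => Or.inl
  obtain ⟨i, hi⟩ := key x' hx'
  obtain ⟨j, hj⟩ := key y' hy'
  exact hxj.trans (hi.trans (((P.joinedIn_boundary_vertices i j).mono fun _ => Or.inl).trans
    (hj.symm.trans hyj.symm)))

end Polygon

/-! ### The winding angle and the shape of the region near its vertices -/

namespace Polygon

variable {n : ℕ} (P : Polygon Plane n)

/-- The total signed angle under which the boundary of the polygon is seen from `x`. -/
noncomputable def windingAngle (x : Plane) : ℝ :=
  ∑ i, subtendedAngle (P i) (P (finRotate n i)) x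

theorem windingAngle_coe {x : Plane} (hx : x ∉ P.boundary ℝ) :
    (P.windingAngle x : Real.Angle) = 0 := by
  have hv : ∀ i, x ≠ P i := by
    rintro i rfl
    exact hx (mem_iUnion.2 ⟨i, by rw [edgeSet_eq_segment]; exact left_mem_segment ℝ _ _⟩)
  have h : ∀ i, (subtendedAngle (P i) (P (finRotate n i)) x : Real.Angle) =
      (Complex.arg (toComplex (P (finRotate n i)) - toComplex x) : Real.Angle) -
        Complex.arg (toComplex (P i) - toComplex x) :=
    fun i => subtendedAngle_coe (hv _) (hv _)
  have hs : (P.windingAngle x : Real.Angle) =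
      ∑ i, (subtendedAngle (P i) (P (finRotate n i)) x : Real.Angle) :=
    map_sum Real.Angle.coeHom _ _
  rw [hs, Finset.sum_congr rfl fun i _ => h i, Finset.sum_sub_distrib,
    Equiv.sum_comp (finRotate n)
      (fun i => (Complex.arg (toComplex (P i) - toComplex x) : Real.Angle)), sub_self]

theorem continuousOn_windingAngle : ContinuousOn P.windingAngle (P.boundary ℝ)ᶜ := by
  refine continuousOn_finsetSum _ fun i _ x hx => ContinuousAt.continuousWithinAt ?_
  refine continuousAt_subtendedAngle fun h => hx (mem_iUnion.2 ⟨i, ?_⟩)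
  rwa [edgeSet_eq_segment]

/-- Off the boundary the winding angle is a multiple of `2π`. It is constant on the connected
complement of the region and tends to `0` at infinity. -/
theorem windingAngle_eq_zero {x : Plane} (hx : x ∉ P.region) : P.windingAngle x = 0 := by
  have hlim : Tendsto P.windingAngle (Bornology.cobounded Plane) (𝓝 0) := by
    have := tendsto_finsetSum (Finset.univ : Finset (Fin n))
      fun i _ => tendsto_subtendedAngle_cobounded (P i) (P (finRotate n i))
    rwa [Finset.sum_const_zero] at this
  have hsmall : ∀ᶠ y in Bornology.cobounded Plane, |P.windingAngle y| < 2 * Real.pi := by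
    have := (continuous_abs.tendsto (0 : ℝ)).comp hlim
    rw [abs_zero] at this
    exact this.eventually_lt_const (by have := Real.pi_pos; positivity)
  have hR : ∀ᶠ y in Bornology.cobounded Plane, y ∉ P.region :=
    Bornology.isBounded_def.1 P.isCompact_region.isBounded
  have hne : (Bornology.cobounded Plane).NeBot := by infer_instance
  obtain ⟨y, hy, hyR⟩ := (hsmall.and hR).exists
  have hsub : P.regionᶜ ⊆ (P.boundary ℝ)ᶜ := compl_subset_compl.2 fun _ => Or.inl
  rw [P.isPreconnected_compl_region.eq_of_coe_angle_eq_zero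
    (P.continuousOn_windingAngle.mono hsub) (fun z hz => P.windingAngle_coe (hsub hz)) hx hyR]
  obtain ⟨k, hk⟩ := Real.Angle.coe_eq_zero_iff.1 (P.windingAngle_coe (hsub hyR))
  rw [← hk, zsmul_eq_mul, abs_mul, abs_of_pos Real.two_pi_pos] at hy
  have h1 : |(k : ℝ)| < 1 := by
    by_contra! h
    nlinarith [Real.two_pi_pos]
  have hk0 : k = 0 := by
    rw [← Int.abs_lt_one_iff]
    exact_mod_cast h1
  rw [← hk, hk0, zero_smul]

variable {P} {i : Fin n}

theorem prev_eq : P ((finRotate n).symm i) = P i + P.toPrev i := by simp [toPrev]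

theorem next_eq : P (finRotate n i) = P i + P.toNext i := by simp [toNext]

theorem IsSimple.notMem_edgeSet (h : P.IsSimple) {k : Fin n} (hi : k ≠ i)
    (hj : k ≠ (finRotate n).symm i) : P i ∉ P.edgeSet ℝ k := by
  intro hk
  have hii : P i ∈ P.edgeSet ℝ i := by
    rw [edgeSet_eq_segment]; exact left_mem_segment ℝ _ _
  by_cases h1 : k = finRotate n i
  · subst h1
    have : P i ∈ ({P (finRotate n i)} : Set Plane) := h.consecutive i ▸ ⟨hii, hk⟩
    exact h.nondegenerate i this
  · by_cases h2 : i = finRotate n k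
    · exact hj (by rw [h2, Equiv.symm_apply_apply])
    · exact Set.disjoint_left.1 (h.nonconsecutive i k (Ne.symm hi) h1 h2) hii hk

theorem smul_add_smul_eq_iff {a b : Plane} (h : LinearIndependent ℝ ![a, b]) {s t s' t' : ℝ} :
    s • a + t • b = s' • a + t' • b ↔ s = s' ∧ t = t' := by
  constructor
  · intro he
    have := LinearIndependent.pair_iff.1 h (s - s') (t - t') (by
      rw [← sub_eq_zero] at he
      rw [← he]; module)
    exact ⟨sub_eq_zero.1 this.1, sub_eq_zero.1 this.2⟩
  · rintro ⟨rfl, rfl⟩; rfl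

/-- Near a vertex, the boundary consists of the two edges at the vertex. -/
theorem IsSimple.exists_local_boundary (h : P.IsSimple)
    (hl : LinearIndependent ℝ ![P.toPrev i, P.toNext i]) :
    ∃ e > 0, e ≤ 1 ∧ ∀ s t : ℝ, |s| < e → |t| < e → ∀ k,
      P i + s • P.toPrev i + t • P.toNext i ∈ P.edgeSet ℝ k →
        (k = i ∧ s = 0 ∧ 0 ≤ t) ∨ (k = (finRotate n).symm i ∧ t = 0 ∧ 0 ≤ s) := by
  have hev : ∀ᶠ p : ℝ × ℝ in 𝓝 (0, 0), ∀ k, k ≠ i → k ≠ (finRotate n).symm i →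
      P i + p.1 • P.toPrev i + p.2 • P.toNext i ∉ P.edgeSet ℝ k := by
    rw [eventually_all]
    intro k
    by_cases hki : k ≠ i ∧ k ≠ (finRotate n).symm i
    · have hcl : IsClosed (P.edgeSet ℝ k) := by
        rw [edgeSet_eq_segment, segment_eq_image_lineMap]
        exact (isCompact_Icc.image (by fun_prop)).isClosed
      have hc : Continuous fun p : ℝ × ℝ => P i + p.1 • P.toPrev i + p.2 • P.toNext i := by fun_prop
      have := hc.continuousAt.eventually_mem (x := (0, 0))
        (hcl.isOpen_compl.mem_nhds (by simpa using h.notMem_edgeSet hki.1 hki.2))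
      filter_upwards [this] with p hp _ _ using hp
    · refine Eventually.of_forall fun p h1 h2 => absurd ⟨h1, h2⟩ hki
  obtain ⟨e, he, hball⟩ := Metric.eventually_nhds_iff.1 hev
  refine ⟨min e 1, lt_min he one_pos, min_le_right _ _, fun s t hs ht k hk => ?_⟩
  have hdist : dist ((s, t) : ℝ × ℝ) (0, 0) < e := by
    rw [Prod.dist_eq, max_lt_iff]
    simp only [dist_zero_right, Real.norm_eq_abs]
    exact ⟨hs.trans_le (min_le_left _ _), ht.trans_le (min_le_left _ _)⟩
  have hk' := fun h1 h2 => hball hdist k h1 h2 hk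
  have hadd : ∀ u v w : Plane, u + v + w = u + (v + w) := add_assoc
  by_cases hki : k = i
  · left
    subst hki
    rw [edgeSet_eq_segment, next_eq, segment_eq_image', hadd] at hk
    obtain ⟨m, hm, hm'⟩ := hk
    have : s • P.toPrev k + t • P.toNext k = (0 : ℝ) • P.toPrev k + m • P.toNext k := by
      simp only [add_sub_cancel_left] at hm'
      rw [← add_left_cancel hm', zero_smul, zero_add]
    obtain ⟨h1, h2⟩ := (smul_add_smul_eq_iff hl).1 this
    exact ⟨rfl, h1, h2 ▸ hm.1⟩
  · right
    have hkj : k = (finRotate n).symm i := by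
      by_contra hkj
      exact hk' hki hkj
    subst hkj
    rw [edgeSet_eq_segment, Equiv.apply_symm_apply, prev_eq, segment_symm, segment_eq_image',
      hadd] at hk
    obtain ⟨m, hm, hm'⟩ := hk
    have : s • P.toPrev i + t • P.toNext i = m • P.toPrev i + (0 : ℝ) • P.toNext i := by
      simp only [add_sub_cancel_left] at hm'
      rw [← add_left_cancel hm', zero_smul, add_zero]
    obtain ⟨h1, h2⟩ := (smul_add_smul_eq_iff hl).1 this
    exact ⟨rfl, h2, h1 ▸ hm.1⟩

/-- Near a reflex vertex, the complement of the region is the open sector between the edges. -/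
theorem IsSimple.exists_local_region (h : P.IsSimple) (hr : P.IsReflex i) :
    ∃ e > 0, e ≤ 1 ∧ ∀ s t : ℝ, |s| < e → |t| < e →
      (P i + s • P.toPrev i + t • P.toNext i ∈ P.region ↔ ¬ (0 < s ∧ 0 < t)) := by
  obtain ⟨hl, e₁, he₁, hsec⟩ := hr
  obtain ⟨e₂, he₂, he₂1, hbd⟩ := h.exists_local_boundary hl
  obtain ⟨e, he, hle₁, hle₂⟩ : ∃ e > 0, e ≤ e₁ ∧ e ≤ e₂ :=
    ⟨min e₁ e₂, lt_min he₁ he₂, min_le_left _ _, min_le_right _ _⟩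
  set a := P.toPrev i
  set b := P.toNext i
  set j := (finRotate n).symm i with hj
  have hij : j ≠ i := by
    intro hji
    have h1 := h.nondegenerate j
    rw [hj, Equiv.apply_symm_apply, ← hj, hji] at h1
    exact h1 rfl
  set f : ℝ × ℝ → Plane := fun p => P i + p.1 • a + p.2 • b with hf
  have hfc : Continuous f := by fun_prop
  -- `S` is the open large sector at the vertex. It is connected and misses the boundary, so one of
  -- its points in the region brings in all of it.
  set S : Set Plane := f '' {p | |p.1| < e ∧ |p.2| < e ∧ (p.1 < 0 ∨ p.2 < 0)} with hS
  have hSp : IsPreconnected S := by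
    refine IsPreconnected.image ?_ _ hfc.continuousOn
    have hU : {p : ℝ × ℝ | |p.1| < e ∧ |p.2| < e ∧ (p.1 < 0 ∨ p.2 < 0)} =
        (Ioo (-e) 0 ×ˢ Ioo (-e) e) ∪ (Ioo (-e) e ×ˢ Ioo (-e) 0) := by
      ext ⟨s, t⟩
      simp only [mem_ofPred_eq, mem_union, mem_prod, mem_Ioo, abs_lt]
      constructor
      · rintro ⟨⟨h1, h2⟩, ⟨h3, h4⟩, h5 | h5⟩
        · exact Or.inl ⟨⟨h1, h5⟩, h3, h4⟩
        · exact Or.inr ⟨⟨h1, h2⟩, h3, h5⟩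
      · rintro (⟨⟨h1, h2⟩, h3, h4⟩ | ⟨⟨h1, h2⟩, h3, h4⟩)
        · exact ⟨⟨h1, by linarith⟩, ⟨h3, h4⟩, Or.inl h2⟩
        · exact ⟨⟨h1, h2⟩, ⟨h3, by linarith⟩, Or.inr h4⟩
    rw [hU]
    refine (isPreconnected_Ioo.prod isPreconnected_Ioo).union (-(e / 2), -(e / 2)) ?_ ?_
      (isPreconnected_Ioo.prod isPreconnected_Ioo) <;>
    exact ⟨⟨by simp only; linarith, by simp only; linarith⟩, by simp only; linarith, by simp only; linarith⟩
  have hSb : S ⊆ (P.boundary ℝ)ᶜ := by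
    rintro _ ⟨⟨s, t⟩, ⟨hs, ht, hst⟩, rfl⟩ hb
    obtain ⟨k, hk⟩ := mem_iUnion.1 hb
    simp only at hs ht hst
    rcases hbd s t (hs.trans_le hle₂) (ht.trans_le hle₂) k hk with ⟨-, h1, h2⟩ | ⟨-, h1, h2⟩ <;>
      rcases hst with h3 | h3 <;> linarith
  -- a point of the large sector close to the edge towards the previous vertex
  have hex : ∃ x ∈ S, x ∈ P.region := by
    -- Otherwise both sides of the edge at `p` are outside the region, and the winding angle
    -- vanishes on both. But it jumps there, since only the term of the edge `j` is discontinuous at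
    -- `p`.
    by_contra! hno
    set p : Plane := P i + (e / 2) • a with hp
    have hpo : p ∈ openSegment ℝ (P j) (P (finRotate n j)) := by
      rw [hj, Equiv.apply_symm_apply, prev_eq, openSegment_symm, openSegment_eq_image']
      exact ⟨e / 2, ⟨by linarith, by linarith⟩, by simp [hp, a]⟩
    have hc : LinearIndependent ℝ ![b, P (finRotate n j) - P j] := by
      rw [hj, Equiv.apply_symm_apply, prev_eq, LinearIndependent.pair_iff]
      intro s t hst
      have := LinearIndependent.pair_iff.1 hl (-t) s (by rw [← hst]; module)
      exact ⟨this.2, by linarith [this.1]⟩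
    set G : Plane → ℝ := fun x => ∑ k ∈ Finset.univ.erase j,
      subtendedAngle (P k) (P (finRotate n k)) x with hG
    have hW : ∀ x, P.windingAngle x = subtendedAngle (P j) (P (finRotate n j)) x + G x := by
      intro x
      exact (Finset.add_sum_erase _ (fun k => subtendedAngle (P k) (P (finRotate n k)) x)
        (Finset.mem_univ j)).symm
    have hGc : ContinuousAt G p := by
      refine tendsto_finsetSum _ fun k hk => continuousAt_subtendedAngle fun hpk => ?_
      rw [← edgeSet_eq_segment] at hpk
      have hpe : p = P i + (e / 2) • a + (0 : ℝ) • b := by simp [hp]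
      rw [hpe] at hpk
      rcases hbd (e / 2) 0 (by rw [abs_of_pos] <;> linarith) (by simpa using he₂) k hpk with
        ⟨-, h1, h2⟩ | ⟨h1, -, -⟩
      · linarith
      · exact Finset.ne_of_mem_erase hk h1
    have ht1 : Tendsto (fun t : ℝ => p + t • b) (𝓝[>] 0) (𝓝 p) := by
      have : ContinuousAt (fun t : ℝ => p + t • b) 0 := by fun_prop
      simp only [ContinuousAt, zero_smul, add_zero] at this
      exact this.mono_left nhdsWithin_le_nhds
    have ht2 : Tendsto (fun t : ℝ => p - t • b) (𝓝[>] 0) (𝓝 p) := by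
      have : ContinuousAt (fun t : ℝ => p - t • b) 0 := by fun_prop
      simp only [ContinuousAt, zero_smul, sub_zero] at this
      exact this.mono_left nhdsWithin_le_nhds
    obtain ⟨t, ht, ht0, hte⟩ := ((eventually_subtendedAngle_add_ne hpo hc (hGc.tendsto.comp ht1)
      (hGc.tendsto.comp ht2)).and (Ioo_mem_nhdsGT he)).exists
    rw [← hW, ← hW] at ht
    apply ht
    rw [P.windingAngle_eq_zero, P.windingAngle_eq_zero]
    · refine hno _ ⟨(e / 2, -t), ⟨?_, ?_, Or.inr ?_⟩, ?_⟩
      · simp only; rw [abs_of_pos] <;> linarith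
      · simp only; rwa [abs_neg, abs_of_pos ht0]
      · simp only; linarith
      · simp only [hf, hp]; module
    · exact hsec (e / 2) t (by linarith) (by linarith) ht0 (by linarith)
  obtain ⟨x, hxS, hxR⟩ := hex
  refine ⟨e, he, hle₂.trans he₂1, fun s t hs ht => ⟨?_, fun hst => ?_⟩⟩
  · rintro hR ⟨hs0, ht0⟩
    exact hsec s t hs0 (by linarith [le_abs_self s]) ht0 (by linarith [le_abs_self t]) hR
  · by_cases hneg : s < 0 ∨ t < 0
    · exact P.mem_region_of_isPreconnected hSp hSb hxS ⟨(s, t), ⟨hs, ht, hneg⟩, rfl⟩ hxR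
    · push Not at hneg
      refine P.mem_region_of_mem_boundary (mem_iUnion.2 ?_)
      rcases hneg.1.eq_or_lt with h0 | h0
      · refine ⟨i, ?_⟩
        rw [edgeSet_eq_segment, next_eq, segment_eq_image']
        exact ⟨t, ⟨hneg.2, by linarith [le_abs_self t]⟩, by simp [← h0, b]⟩
      · have ht0 : t = 0 := le_antisymm (not_lt.1 fun h => hst ⟨h0, h⟩) hneg.2
        refine ⟨j, ?_⟩
        rw [edgeSet_eq_segment, hj, Equiv.apply_symm_apply, prev_eq, segment_symm, segment_eq_image']
        exact ⟨s, ⟨hneg.1, by linarith [le_abs_self s]⟩, by simp [ht0, a]⟩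

/-- The region contains a segment around each of its points that is not a vertex, and around each
reflex vertex. -/
theorem IsSimple.exists_vertex_of_not_isFlatAt (h : P.IsSimple) {x : Plane} (hx : x ∈ P.region)
    (hf : ¬ IsFlatAt P.region x) : ∃ k, P k = x ∧ ¬ P.IsReflex k := by
  by_cases hb : x ∈ P.boundary ℝ
  swap
  · exact absurd (isFlatAt_of_mem_nhds (P.region_mem_nhds hx hb)) hf
  obtain ⟨k, hk⟩ := mem_iUnion.1 hb
  have hv : ∃ k, P k = x := by
    by_contra! hno
    apply hf
    refine isFlatAt_of_mem_openSegment (h.nondegenerate k) ?_ ?_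
    · rw [← edgeSet_eq_segment]
      exact (subset_iUnion _ k).trans fun _ => Or.inl
    · rw [edgeSet_eq_segment] at hk
      exact mem_openSegment_of_ne_left_right (hno k) (hno _) hk
  obtain ⟨k, rfl⟩ := hv
  refine ⟨k, rfl, fun hr => hf ?_⟩
  obtain ⟨e, he, -, hloc⟩ := h.exists_local_region hr
  refine ⟨P.toPrev k, by simpa using hr.1.ne_zero 0, ?_⟩
  filter_upwards [Metric.ball_mem_nhds (0 : ℝ) he] with t ht
  have := (hloc t 0 (by simpa using ht) (by simpa using he)).2 (by simp)
  simpa using this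

end Polygon

/-! ### Chords -/

/-- The part of the ray from `v` in direction `d` that is visible from `v` in `R`. -/
def chord (R : Set Plane) (v d : Plane) : Set Plane :=
  {x | segment ℝ v x ⊆ R ∧ ∃ r : ℝ, 0 ≤ r ∧ x = v + r • d}

theorem chord_subset (R : Set Plane) (v d : Plane) : chord R v d ⊆ R :=
  fun x hx => hx.1 (right_mem_segment ℝ v x)

theorem segment_ray (v d : Plane) {r : ℝ} :
    segment ℝ v (v + r • d) = (fun m : ℝ => v + (m * r) • d) '' Icc 0 1 := by
  rw [segment_eq_image']
  simp [smul_smul]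

theorem mem_segment_ray {v d : Plane} {r s : ℝ} (hs : 0 ≤ s) (hsr : s ≤ r) :
    v + s • d ∈ segment ℝ v (v + r • d) := by
  rw [segment_ray]
  rcases hs.eq_or_lt with rfl | hs
  · exact ⟨0, by simp, by simp⟩
  · have hr : 0 < r := by linarith
    exact ⟨s / r, ⟨by positivity, (div_le_one hr).2 hsr⟩, by simp only; rw [div_mul_cancel₀ _ hr.ne']⟩

theorem isCompact_segment (a b : Plane) : IsCompact (segment ℝ a b) := by
  rw [segment_eq_image_lineMap]
  exact isCompact_Icc.image (by fun_prop)

theorem isClosed_visible {R : Set Plane} (hR : IsClosed R) {X : Type*} [TopologicalSpace X]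
    {v : Plane} {f : X → Plane} (hf : Continuous f) : IsClosed {x | segment ℝ v (f x) ⊆ R} := by
  have : {x | segment ℝ v (f x) ⊆ R} = ⋂ m ∈ Icc (0 : ℝ) 1, {x | v + m • (f x - v) ∈ R} := by
    ext x
    simp only [segment_eq_image', image_subset_iff, mem_ofPred_eq, mem_iInter]
    rfl
  rw [this]
  exact isClosed_biInter fun m _ => hR.preimage (by fun_prop)

/-- A chord is a segment, and the ray leaves the region at its end. -/
theorem exists_chord_end {R : Set Plane} (hR : IsCompact R)
    (hstar : ∀ x ∈ R, ∃ r > 0, ∀ y ∈ Metric.ball x r, y ∈ R → segment ℝ x y ⊆ R)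
    {v d : Plane} (hv : v ∈ R) (hd : d ≠ 0) :
    ∃ T : ℝ, 0 ≤ T ∧ chord R v d = segment ℝ v (v + T • d) ∧
      ∃ T' > T, ∀ r, T < r → r ≤ T' → v + r • d ∉ R := by
  have hd0 : 0 < ‖d‖ := norm_pos_iff.2 hd
  obtain ⟨B, hB⟩ := hR.isBounded.subset_closedBall v
  have hcl : IsClosed {r : ℝ | segment ℝ v (v + r • d) ⊆ R} :=
    isClosed_visible hR.isClosed (by fun_prop)
  have hA : IsCompact ({r : ℝ | segment ℝ v (v + r • d) ⊆ R} ∩ Ici 0) := by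
    refine (isCompact_Icc (a := 0) (b := B / ‖d‖)).of_isClosed_subset (hcl.inter isClosed_Ici) ?_
    rintro r ⟨hr, hr0⟩
    have hr0 : 0 ≤ r := hr0
    have h1 := hB (hr (right_mem_segment ℝ _ _))
    rw [Metric.mem_closedBall, dist_eq_norm, add_sub_cancel_left, norm_smul, Real.norm_eq_abs,
      abs_of_nonneg hr0] at h1
    exact ⟨hr0, (le_div_iff₀ hd0).2 h1⟩
  obtain ⟨T, ⟨hTR, hT0⟩, hT⟩ := hA.exists_isGreatest ⟨0, by simpa using hv, by simp⟩
  have hTR : segment ℝ v (v + T • d) ⊆ R := hTR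
  have hT0 : 0 ≤ T := hT0
  refine ⟨T, hT0, ?_, ?_⟩
  · ext x
    constructor
    · rintro ⟨hx, r, hr, rfl⟩
      exact mem_segment_ray hr (hT ⟨hx, hr⟩)
    · intro hx
      refine ⟨((convex_segment _ _).segment_subset (left_mem_segment ℝ _ _) hx).trans hTR, ?_⟩
      rw [segment_ray] at hx
      obtain ⟨m, hm, rfl⟩ := hx
      exact ⟨m * T, mul_nonneg hm.1 hT0, rfl⟩
  · obtain ⟨e, he, hst⟩ := hstar _ (hTR (right_mem_segment ℝ _ _))
    refine ⟨T + e / (2 * ‖d‖), by simp; positivity, fun r hr hr' hrR => ?_⟩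
    have hball : v + r • d ∈ Metric.ball (v + T • d) e := by
      rw [Metric.mem_ball, dist_eq_norm, add_sub_add_left_eq_sub, ← sub_smul, norm_smul,
        Real.norm_eq_abs, abs_of_pos (sub_pos.2 hr)]
      calc (r - T) * ‖d‖ ≤ e / (2 * ‖d‖) * ‖d‖ := by gcongr; linarith
        _ = e / 2 := by field_simp
        _ < e := by linarith
    have hseg := hst _ hball hrR
    have hmem : r ∈ {r : ℝ | segment ℝ v (v + r • d) ⊆ R} ∩ Ici 0 := by
      refine ⟨?_, by simp; linarith⟩
      change segment ℝ v (v + r • d) ⊆ R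
      rw [segment_ray]
      rintro _ ⟨m, ⟨hm0, hm1⟩, rfl⟩
      simp only
      by_cases hmT : m * r ≤ T
      · exact hTR (mem_segment_ray (by nlinarith) hmT)
      · push Not at hmT
        apply hseg
        have h1 := mem_segment_ray (v := v + T • d) (d := d) (r := r - T) (s := m * r - T)
          (by linarith) (by nlinarith)
        have h2 : v + T • d + (m * r - T) • d = v + (m * r) • d := by module
        have h3 : v + T • d + (r - T) • d = v + r • d := by module
        rwa [h2, h3] at h1
    linarith [hT hmem]

/-! ### Reflex corners in coordinates -/

/-- In the coordinates given by `a` and `b`, the set `R` is near `v` the complement of an open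
quadrant. -/
structure IsReflexCorner (R : Set Plane) (v a b : Plane) (e : ℝ) : Prop where
  linearIndependent : LinearIndependent ℝ ![a, b]
  pos : 0 < e
  mem_iff : ∀ s t : ℝ, |s| < e → |t| < e → (v + s • a + t • b ∈ R ↔ ¬ (0 < s ∧ 0 < t))

namespace IsReflexCorner

variable {R : Set Plane} {v a b : Plane} {e : ℝ}

theorem coords_eq_iff (h : IsReflexCorner R v a b e) {s t s' t' : ℝ} :
    v + s • a + t • b = v + s' • a + t' • b ↔ s = s' ∧ t = t' := by
  rw [add_assoc, add_assoc, add_right_inj, Polygon.smul_add_smul_eq_iff h.linearIndependent]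

theorem eventually_coords (h : IsReflexCorner R v a b e) (z : Plane) {δ : ℝ} (hδ : 0 < δ) :
    ∀ᶠ y in 𝓝 z, ∃ s t : ℝ, |s| < δ ∧ |t| < δ ∧ y = z + s • a + t • b := by
  let B := basisOfLinearIndependentOfCardEqFinrank h.linearIndependent (by simp [Plane])
  have hB0 : B 0 = a := by simp [B]
  have hB1 : B 1 = b := by simp [B]
  have hev : ∀ i, ∀ᶠ y in 𝓝 z, |B.coord i (y - z)| < δ := by
    intro i
    have hc : Continuous (B.coord i) := LinearMap.continuous_of_finiteDimensional _
    have : ContinuousAt (fun y => |B.coord i (y - z)|) z := by fun_prop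
    exact this.eventually_lt_const (by simpa using hδ)
  filter_upwards [hev 0, hev 1] with y h0 h1
  refine ⟨_, _, h0, h1, ?_⟩
  have := B.sum_repr (y - z)
  rw [Fin.sum_univ_two, hB0, hB1] at this
  rw [add_assoc, Module.Basis.coord_apply, Module.Basis.coord_apply, this]
  abel

/-- This functional recovers the ray parameter of a point on a chord simultaneously for all
directions `-((1 - θ) • a + θ • b)`, on which it takes the value `-1`. -/
theorem exists_height (h : IsReflexCorner R v a b e) :
    ∃ f : Plane →L[ℝ] ℝ, f a = 1 ∧ f b = 1 := by
  let B := basisOfLinearIndependentOfCardEqFinrank h.linearIndependent (by simp [Plane])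
  have hB0 : B 0 = a := by simp [B]
  have hB1 : B 1 = b := by simp [B]
  refine ⟨LinearMap.toContinuousLinearMap (B.coord 0 + B.coord 1), ?_, ?_⟩
  · rw [← hB0]; simp
  · rw [← hB1]; simp

theorem mem_interior (h : IsReflexCorner R v a b e) {s t : ℝ} (hs : |s| < e) (ht : |t| < e)
    (hst : s < 0 ∨ t < 0) : v + s • a + t • b ∈ interior R := by
  have key : ∃ δ > 0, ∀ s' t' : ℝ, |s'| < δ → |t'| < δ → |s + s'| < e ∧ |t + t'| < e ∧
      (s + s' < 0 ∨ t + t' < 0) := by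
    have h1 : ∀ᶠ p : ℝ × ℝ in 𝓝 (0, 0), |s + p.1| < e ∧ |t + p.2| < e ∧
        (s + p.1 < 0 ∨ t + p.2 < 0) := by
      have c1 : ContinuousAt (fun p : ℝ × ℝ => |s + p.1|) (0, 0) := by fun_prop
      have c2 : ContinuousAt (fun p : ℝ × ℝ => |t + p.2|) (0, 0) := by fun_prop
      have c3 : ContinuousAt (fun p : ℝ × ℝ => s + p.1) (0, 0) := by fun_prop
      have c4 : ContinuousAt (fun p : ℝ × ℝ => t + p.2) (0, 0) := by fun_prop
      refine (c1.eventually_lt_const (by simpa)).and ((c2.eventually_lt_const (by simpa)).and ?_)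
      rcases hst with h | h
      · exact (c3.eventually_lt_const (by simpa)).mono fun _ => Or.inl
      · exact (c4.eventually_lt_const (by simpa)).mono fun _ => Or.inr
    obtain ⟨δ, hδ, hb⟩ := Metric.eventually_nhds_iff.1 h1
    refine ⟨δ, hδ, fun s' t' hs' ht' => hb (y := (s', t')) ?_⟩
    rw [Prod.dist_eq, max_lt_iff]
    simpa using ⟨hs', ht'⟩
  obtain ⟨δ, hδ, hkey⟩ := key
  rw [mem_interior_iff_mem_nhds]
  filter_upwards [h.eventually_coords (v + s • a + t • b) hδ]
  rintro _ ⟨s', t', hs', ht', rfl⟩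
  obtain ⟨h1, h2, h3⟩ := hkey s' t' hs' ht'
  rw [show v + s • a + t • b + s' • a + t' • b = v + (s + s') • a + (t + t') • b by module,
    h.mem_iff _ _ h1 h2]
  rintro ⟨h4, h5⟩
  rcases h3 with h3 | h3 <;> linarith

theorem apex_mem (h : IsReflexCorner R v a b e) : v ∈ R := by
  have := (h.mem_iff 0 0 (by simpa using h.pos) (by simpa using h.pos)).2 (by simp)
  simpa using this

theorem direction_ne_zero (h : IsReflexCorner R v a b e) {α β : ℝ} (hαβ : 0 < α ^ 2 + β ^ 2) :
    -(α • a + β • b) ≠ 0 := by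
  intro h0
  obtain ⟨rfl, rfl⟩ := LinearIndependent.pair_iff.1 h.linearIndependent α β (neg_eq_zero.1 h0)
  simp at hαβ

theorem coords_of_mem_chord (h : IsReflexCorner R v a b e) {α β s t : ℝ}
    (hx : v + s • a + t • b ∈ chord R v (-(α • a + β • b))) :
    ∃ r, 0 ≤ r ∧ s = -(r * α) ∧ t = -(r * β) := by
  obtain ⟨-, r, hr, he⟩ := hx
  refine ⟨r, hr, h.coords_eq_iff.1 ?_⟩
  rw [he]
  module

theorem mem_chord (h : IsReflexCorner R v a b e) {α β r : ℝ} (hα : 0 ≤ α) (hβ : 0 ≤ β)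
    (hr : 0 ≤ r) (hrα : r * α < e) (hrβ : r * β < e) :
    v + r • (-(α • a + β • b)) ∈ chord R v (-(α • a + β • b)) := by
  refine ⟨?_, r, hr, rfl⟩
  rw [segment_ray]
  rintro _ ⟨m, ⟨hm0, hm1⟩, rfl⟩
  have he : v + (m * r) • -(α • a + β • b) = v + (-(m * (r * α))) • a + (-(m * (r * β))) • b := by
    module
  simp only [he]
  have h1 : 0 ≤ m * (r * α) := by positivity
  have h2 : 0 ≤ m * (r * β) := by positivity
  refine (h.mem_iff _ _ ?_ ?_).2 fun h3 => by linarith [h3.1]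
  · rw [abs_neg, abs_of_nonneg h1]
    nlinarith [mul_nonneg hr hα]
  · rw [abs_neg, abs_of_nonneg h2]
    nlinarith [mul_nonneg hr hβ]

/-- Near the apex, the points on the one side of a chord are joined to the edge along `a`. -/
theorem joinedIn_left (h : IsReflexCorner R v a b e) {α β s t : ℝ} (hα : 0 ≤ α) (hβ : 0 ≤ β)
    (hs : |s| < e) (ht : |t| < e) (hx : v + s • a + t • b ∈ R)
    (hside : 0 < s * β - t * α ∨ (0 < s ∧ t = 0 ∧ β = 0)) :
    JoinedIn (R \ chord R v (-(α • a + β • b))) (v + s • a + t • b) (v + (e / 2) • a) := by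
  have he := h.pos
  rw [h.mem_iff s t hs ht] at hx
  rw [abs_lt] at hs ht
  -- The straight segment works: `t ≤ 0` keeps it out of the missing quadrant, and the determinant
  -- `s * β - t * α`, which vanishes on the chord, stays positive before the end. The second case of
  -- `hside` is a start on the edge when the chord is its extension; there the first coordinate
  -- separates the two.
  apply joinedIn_of_segment_subset
  rw [segment_eq_image']
  rintro _ ⟨m, ⟨hm0, hm1⟩, rfl⟩
  have hco : v + s • a + t • b + m • (v + (e / 2) • a - (v + s • a + t • b)) =
      v + ((1 - m) * s + m * (e / 2)) • a + ((1 - m) * t) • b := by module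
  simp only [hco]
  have ht0 : t ≤ 0 := by
    by_contra! ht0
    rcases hside with h1 | h1
    · have hs0 : s ≤ 0 := not_lt.1 fun h' => hx ⟨h', ht0⟩
      nlinarith
    · linarith [h1.2.1]
  have h1m : 0 ≤ 1 - m := by linarith
  constructor
  · refine (h.mem_iff _ _ ?_ ?_).2 fun h3 => by nlinarith [h3.2]
    · rw [abs_lt]; constructor <;> nlinarith
    · rw [abs_lt]; constructor <;> nlinarith
  · intro hmem
    obtain ⟨r, hr, h1, h2⟩ := h.coords_of_mem_chord hmem
    have hrα : 0 ≤ r * α := by positivity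
    rcases hside with h3 | ⟨h3, -, -⟩
    · rcases hm1.eq_or_lt with rfl | hm1
      · linarith
      · have h4 : ((1 - m) * s + m * (e / 2)) * β - ((1 - m) * t) * α = 0 := by rw [h1, h2]; ring
        have h5 : 0 < (1 - m) * (s * β - t * α) := mul_pos (by linarith) h3
        have h6 : 0 ≤ m * (e / 2) * β := by positivity
        nlinarith
    · rcases hm0.eq_or_lt with rfl | hm0
      · linarith
      · have h4 : 0 < m * (e / 2) := by positivity
        have h5 : 0 ≤ (1 - m) * s := by positivity
        linarith

theorem symm (h : IsReflexCorner R v a b e) : IsReflexCorner R v b a e where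
  linearIndependent := by
    rw [LinearIndependent.pair_iff]
    intro s t hst
    have := LinearIndependent.pair_iff.1 h.linearIndependent t s (by rw [← hst]; abel)
    exact ⟨this.2, this.1⟩
  pos := h.pos
  mem_iff s t hs ht := by
    rw [show v + s • b + t • a = v + t • a + s • b by abel, h.mem_iff t s ht hs, and_comm]

theorem joinedIn_right (h : IsReflexCorner R v a b e) {α β s t : ℝ} (hα : 0 ≤ α) (hβ : 0 ≤ β)
    (hs : |s| < e) (ht : |t| < e) (hx : v + s • a + t • b ∈ R)
    (hside : s * β - t * α < 0 ∨ (0 < t ∧ s = 0 ∧ α = 0)) :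
    JoinedIn (R \ chord R v (-(α • a + β • b))) (v + s • a + t • b) (v + (e / 2) • b) := by
  have he : v + s • a + t • b = v + t • b + s • a := by abel
  rw [he] at hx ⊢
  rw [add_comm (α • a)]
  refine h.symm.joinedIn_left hβ hα ht hs hx (hside.imp (fun h => by linarith) fun h => h)

/-- Near the apex, every point off a chord is joined to one of the two edges. -/
theorem joinedIn_or (h : IsReflexCorner R v a b e) {α β s t : ℝ} (hα : 0 ≤ α) (hβ : 0 ≤ β)
    (hαβ : 0 < α ^ 2 + β ^ 2)
    (hs : |s| < e) (ht : |t| < e) (hx : v + s • a + t • b ∈ R)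
    (hch : v + s • a + t • b ∉ chord R v (-(α • a + β • b))) :
    JoinedIn (R \ chord R v (-(α • a + β • b))) (v + s • a + t • b) (v + (e / 2) • a) ∨
    JoinedIn (R \ chord R v (-(α • a + β • b))) (v + s • a + t • b) (v + (e / 2) • b) := by
  rcases lt_trichotomy (s * β - t * α) 0 with h1 | h1 | h1
  · exact Or.inr (h.joinedIn_right hα hβ hs ht hx (Or.inl h1))
  swap
  · exact Or.inl (h.joinedIn_left hα hβ hs ht hx (Or.inl h1))
  -- The determinant vanishes, so `(s, t) = l • (α, β)`. If `l ≤ 0` the point is on the chord; if `l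
  -- > 0` it lies in `R` only on an edge.
  set l : ℝ := (s * α + t * β) / (α ^ 2 + β ^ 2) with hl
  have hsl : s = l * α := by
    rw [hl]; field_simp; linear_combination β * h1
  have htl : t = l * β := by
    rw [hl]; field_simp; linear_combination -α * h1
  by_cases hl0 : l ≤ 0
  · exfalso
    apply hch
    have := h.mem_chord (r := -l) hα hβ (by linarith)
      (by have := (abs_lt.1 hs).1; linarith) (by have := (abs_lt.1 ht).1; linarith)
    convert this using 1
    rw [hsl, htl]; module
  · push Not at hl0
    have hst := (h.mem_iff s t hs ht).1 hx
    rcases hα.eq_or_lt with rfl | hα'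
    · have hβ' : 0 < β := lt_of_le_of_ne hβ (by rintro rfl; simp at hαβ)
      exact Or.inr (h.joinedIn_right le_rfl hβ hs ht hx
        (Or.inr ⟨by rw [htl]; positivity, by simp [hsl], rfl⟩))
    · have hβ' : β = 0 := by
        by_contra hne
        have hβ' : 0 < β := lt_of_le_of_ne hβ (Ne.symm hne)
        exact hst ⟨by rw [hsl]; positivity, by rw [htl]; positivity⟩
      exact Or.inl (h.joinedIn_left hα hβ hs ht hx
        (Or.inr ⟨by rw [hsl]; positivity, by simp [htl, hβ'], hβ'⟩))

end IsReflexCorner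

theorem Polygon.IsSimple.exists_isReflexCorner {n : ℕ} {P : Polygon Plane n} (h : P.IsSimple)
    {i : Fin n} (hr : P.IsReflex i) :
    ∃ e, IsReflexCorner P.region (P i) (P.toPrev i) (P.toNext i) e := by
  obtain ⟨e, he, -, hloc⟩ := h.exists_local_region hr
  exact ⟨e, hr.1, he, hloc⟩

/-! ### A chord separates the two edges at its apex -/

/-- The angle under which two points of a connected open set are seen from outside that set has a
continuous determination. -/
theorem exists_angle_function {E : Set Plane} (hE : IsOpen E) (hc : IsPreconnected E)
    {x y : Plane} (hx : x ∈ E) (hy : y ∈ E) :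
    ∃ F : Plane → ℝ, ContinuousOn F Eᶜ ∧ ∀ z ∈ Eᶜ, (F z : Real.Angle) =
      (Complex.arg (toComplex y - toComplex z) : Real.Angle) -
        Complex.arg (toComplex x - toComplex z) := by
  -- Nearby points are joined by a segment in `E`, whose subtended angle serves; sums and negatives
  -- of determinations give transitivity and symmetry.
  refine hc.induction₂ (fun x y => ∃ F : Plane → ℝ, ContinuousOn F Eᶜ ∧ ∀ z ∈ Eᶜ,
    (F z : Real.Angle) = (Complex.arg (toComplex y - toComplex z) : Real.Angle) -
        Complex.arg (toComplex x - toComplex z)) ?_ ?_ ?_ hx hy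
  · intro x hx
    obtain ⟨r, hr, hball⟩ := Metric.mem_nhds_iff.1 (hE.mem_nhds hx)
    filter_upwards [nhdsWithin_le_nhds (Metric.ball_mem_nhds x hr)] with y hy
    have hseg : segment ℝ x y ⊆ E :=
      ((convex_ball x r).segment_subset (Metric.mem_ball_self hr) hy).trans hball
    refine ⟨subtendedAngle x y, fun z hz => ?_, fun z hz => subtendedAngle_coe ?_ ?_⟩
    · exact (continuousAt_subtendedAngle fun h => hz (hseg h)).continuousWithinAt
    · rintro rfl; exact hz hx
    · rintro rfl; exact hz (hball hy)
  · rintro x y z - - - ⟨F, hF, hF'⟩ ⟨G, hG, hG'⟩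
    refine ⟨fun w => F w + G w, hF.add hG, fun w hw => ?_⟩
    rw [Real.Angle.coe_add, hF' w hw, hG' w hw]
    abel
  · rintro x y - - ⟨F, hF, hF'⟩
    refine ⟨fun w => -F w, hF.neg, fun w hw => ?_⟩
    rw [Real.Angle.coe_neg, hF' w hw, neg_sub]

theorem JoinedIn.isPreconnected_range {F : Set Plane} {x y : Plane} (h : JoinedIn F x y) :
    IsPreconnected (range h.somePath) := by
  rw [← image_univ]
  exact isPreconnected_univ.image _ h.somePath.continuous.continuousOn

theorem JoinedIn.eq_of_coe_angle_eq_zero {D : Set Plane} {x y : Plane} (h : JoinedIn D x y)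
    {W : Plane → ℝ} (hW : ContinuousOn W D) (h0 : ∀ x ∈ D, (W x : Real.Angle) = 0) : W x = W y := by
  have hsub : range h.somePath ⊆ D := by
    rintro _ ⟨t, rfl⟩
    exact h.somePath_mem t
  exact h.isPreconnected_range.eq_of_coe_angle_eq_zero (hW.mono hsub)
    (fun z hz => h0 z (hsub hz)) ⟨0, h.somePath.source⟩ ⟨1, h.somePath.target⟩

/-- A chord from a reflex corner separates the two edges at the corner. -/
theorem IsReflexCorner.not_joinedIn {R : Set Plane} {v a b : Plane} {e : ℝ}
    (h : IsReflexCorner R v a b e) (hR : IsCompact R) (hc : IsPreconnected Rᶜ)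
    (hstar : ∀ x ∈ R, ∃ r > 0, ∀ y ∈ Metric.ball x r, y ∈ R → segment ℝ x y ⊆ R)
    {α β : ℝ} (hα : 0 ≤ α) (hβ : 0 ≤ β) (hαβ : 0 < α ^ 2 + β ^ 2) :
    ¬ JoinedIn (R \ chord R v (-(α • a + β • b))) (v + (e / 2) • a) (v + (e / 2) • b) := by
  intro hj
  have he := h.pos
  have hv := h.apex_mem
  set d := -(α • a + β • b) with hd
  obtain ⟨T, hT0, hchord, T', hTT', hout⟩ := exists_chord_end hR hstar hv (h.direction_ne_zero hαβ)
  rw [← hd] at hchord hout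
  -- The loop runs from `v` along the chord to `q` just outside, through the connected complement to
  -- `v'` in the missing quadrant, and straight back to `v`.
  set q := v + T' • d with hq
  set v' := v + (e / 2) • a + (e / 2) • b with hv'
  have hqR : q ∈ Rᶜ := hout T' hTT' le_rfl
  have habs : |e / 2| < e := by rw [abs_of_pos] <;> linarith
  have hv'R : v' ∈ Rᶜ := by
    rw [mem_compl_iff, h.mem_iff _ _ habs habs]
    push Not
    constructor <;> linarith
  obtain ⟨F, hF, hF'⟩ := exists_angle_function hR.isClosed.isOpen_compl hc hqR hv'R
  rw [compl_compl] at hF hF'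
  -- the loop meets the region only in the chord
  have hseg1 : ∀ z ∈ R, z ∈ segment ℝ v q → z ∈ chord R v d := by
    intro z hz hzs
    rw [hq, segment_ray] at hzs
    obtain ⟨m, ⟨hm0, hm1⟩, rfl⟩ := hzs
    have h1 : 0 ≤ m * T' := by nlinarith
    have h2 : m * T' ≤ T := by
      by_contra! h2
      exact hout _ h2 (by nlinarith) hz
    rw [hchord]
    exact mem_segment_ray h1 h2
  have hseg2 : ∀ z ∈ R, z ∈ segment ℝ v' v → z = v := by
    intro z hz hzs
    rw [segment_symm, segment_eq_image'] at hzs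
    obtain ⟨m, ⟨hm0, hm1⟩, rfl⟩ := hzs
    have hco : v + m • (v' - v) = v + (m * (e / 2)) • a + (m * (e / 2)) • b := by rw [hv']; module
    simp only [hco] at hz ⊢
    have h1 : |m * (e / 2)| < e := by rw [abs_of_nonneg] <;> nlinarith
    rw [h.mem_iff _ _ h1 h1] at hz
    have : m = 0 := by
      by_contra hne
      have : 0 < m := lt_of_le_of_ne hm0 (Ne.symm hne)
      exact hz ⟨by positivity, by positivity⟩
    simp [this]
  have hvch : v ∈ chord R v d := hseg1 v hv (left_mem_segment ℝ _ _)
  -- `G` is the angle of the loop without the part from `v` to `q`. The full angle is a multiple of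
  -- `2π` and constant along paths off the chord, yet it jumps across the chord, where `G` is
  -- continuous.
  set G : Plane → ℝ := fun z => F z + subtendedAngle v' v z with hG
  have hGc : ∀ z ∈ R, z ≠ v → ContinuousWithinAt G R z := fun z hz hzv =>
    (hF z hz).add (continuousAt_subtendedAngle fun h => hzv (hseg2 z hz h)).continuousWithinAt
  have hconst : ∀ {x y : Plane}, JoinedIn (R \ chord R v d) x y →
      subtendedAngle v q x + G x = subtendedAngle v q y + G y := by
    intro x y hxy
    refine hxy.eq_of_coe_angle_eq_zero (W := fun z => subtendedAngle v q z + G z) ?_ ?_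
    · rintro z ⟨hz, hzc⟩
      refine ContinuousWithinAt.add ?_ ((hGc z hz ?_).mono sdiff_subset)
      · exact (continuousAt_subtendedAngle fun h => hzc (hseg1 z hz h)).continuousWithinAt
      · rintro rfl; exact hzc hvch
    · rintro z ⟨hz, hzc⟩
      have hzv : z ≠ v := by rintro rfl; exact hzc hvch
      have hzq : z ≠ q := by rintro rfl; exact hqR hz
      have hzv' : z ≠ v' := by rintro rfl; exact hv'R hz
      rw [Real.Angle.coe_add, Real.Angle.coe_add, hF' z hz, subtendedAngle_coe hzv hzq,
        subtendedAngle_coe hzv' hzv]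
      abel
  -- a point of the chord near the corner, and a transversal direction
  set r : ℝ := e / (2 * (α + β + 1)) with hr
  have hr0 : 0 < r := by positivity
  have hrα : r * α < e / 2 := by
    rw [hr, div_mul_eq_mul_div, div_lt_div_iff₀ (by positivity) two_pos]; nlinarith [mul_nonneg he.le hβ]
  have hrβ : r * β < e / 2 := by
    rw [hr, div_mul_eq_mul_div, div_lt_div_iff₀ (by positivity) two_pos]; nlinarith [mul_nonneg he.le hα]
  have hrT : r < T' := by
    by_contra! hle
    refine hqR (chord_subset R v d (h.mem_chord hα hβ (by linarith) ?_ ?_)) <;> nlinarith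
  set p := v + r • d with hp
  set c := β • a - α • b with hcdef
  have hco : ∀ t : ℝ, p + t • c = v + (-(r * α) + t * β) • a + (-(r * β) - t * α) • b := by
    intro t; rw [hp, hd, hcdef]; module
  have hco' : ∀ t : ℝ, p - t • c = v + (-(r * α) - t * β) • a + (-(r * β) + t * α) • b := by
    intro t; rw [hp, hd, hcdef]; module
  have hpo : p ∈ openSegment ℝ v q := by
    rw [openSegment_eq_image']
    refine ⟨r / T', ⟨by apply div_pos <;> linarith, (div_lt_one (by linarith)).2 hrT⟩, ?_⟩
    have : T' ≠ 0 := by linarith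
    simp only [hq, hp, add_sub_cancel_left, smul_smul, div_mul_cancel₀ _ this]
  have hli : LinearIndependent ℝ ![c, q - v] := by
    rw [LinearIndependent.pair_iff]
    intro x y hxy
    obtain ⟨h1, h2⟩ := LinearIndependent.pair_iff.1 h.linearIndependent
      (x * β - y * T' * α) (-(x * α) - y * T' * β) (by rw [← hxy, hcdef, hq, hd]; module)
    have h3 : x * (α ^ 2 + β ^ 2) = 0 := by linear_combination β * h1 - α * h2
    have h4 : y * (T' * (α ^ 2 + β ^ 2)) = 0 := by linear_combination -α * h1 - β * h2
    have h5 : T' * (α ^ 2 + β ^ 2) ≠ 0 := mul_ne_zero (by linarith) hαβ.ne'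
    exact ⟨(mul_eq_zero.1 h3).resolve_right hαβ.ne', (mul_eq_zero.1 h4).resolve_right h5⟩
  have hsmall : ∀ᶠ t : ℝ in 𝓝[>] 0, 0 < t ∧ t * α < e / 2 ∧ t * β < e / 2 := by
    have h1 : ∀ x : ℝ, ∀ᶠ t : ℝ in 𝓝[>] 0, t * x < e / 2 := by
      intro x
      have : ContinuousAt (fun t : ℝ => t * x) 0 := by fun_prop
      exact (this.eventually_lt_const (by simpa)).filter_mono nhdsWithin_le_nhds
    filter_upwards [self_mem_nhdsWithin, h1 α, h1 β] with t ht h1 h2 using ⟨ht, h1, h2⟩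
  have hrα0 : 0 ≤ r * α := by positivity
  have hrβ0 : 0 ≤ r * β := by positivity
  have hplus : ∀ t : ℝ, 0 < t → t * α < e / 2 → t * β < e / 2 →
      p + t • c ∈ R ∧ JoinedIn (R \ chord R v d) (p + t • c) (v + (e / 2) • a) := by
    intro t ht h1 h2
    have h3 : 0 ≤ t * α := by positivity
    have h4 : 0 ≤ t * β := by positivity
    have hs : |-(r * α) + t * β| < e := by rw [abs_lt]; constructor <;> linarith
    have hs' : |-(r * β) - t * α| < e := by rw [abs_lt]; constructor <;> linarith
    rw [hco]
    have hm := (h.mem_iff _ _ hs hs').2 fun h5 => by linarith [h5.2]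
    exact ⟨hm, h.joinedIn_left hα hβ hs hs' hm (Or.inl (by nlinarith [mul_pos ht hαβ]))⟩
  have hminus : ∀ t : ℝ, 0 < t → t * α < e / 2 → t * β < e / 2 →
      p - t • c ∈ R ∧ JoinedIn (R \ chord R v d) (p - t • c) (v + (e / 2) • b) := by
    intro t ht h1 h2
    have h3 : 0 ≤ t * α := by positivity
    have h4 : 0 ≤ t * β := by positivity
    have hs : |-(r * α) - t * β| < e := by rw [abs_lt]; constructor <;> linarith
    have hs' : |-(r * β) + t * α| < e := by rw [abs_lt]; constructor <;> linarith
    rw [hco']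
    have hm := (h.mem_iff _ _ hs hs').2 fun h5 => by linarith [h5.1]
    exact ⟨hm, h.joinedIn_right hα hβ hs hs' hm (Or.inl (by nlinarith [mul_pos ht hαβ]))⟩
  have hpR : p ∈ R := chord_subset R v d (h.mem_chord hα hβ hr0.le (by linarith) (by linarith))
  have hpv : p ≠ v := by
    intro hpv
    have := smul_ne_zero hr0.ne' (h.direction_ne_zero hαβ)
    exact this (by rw [← hd]; simpa [hp] using hpv)
  have hlim : ∀ w : Plane, Tendsto (fun t : ℝ => p + t • w) (𝓝[>] 0) (𝓝 p) := by
    intro w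
    have : ContinuousAt (fun t : ℝ => p + t • w) 0 := by fun_prop
    simp only [ContinuousAt, zero_smul, add_zero] at this
    exact this.mono_left nhdsWithin_le_nhds
  have hG1 : Tendsto (fun t : ℝ => G (p + t • c)) (𝓝[>] 0) (𝓝 (G p)) := by
    refine (hGc p hpR hpv).tendsto.comp (tendsto_nhdsWithin_iff.2 ⟨hlim c, ?_⟩)
    filter_upwards [hsmall] with t ht using (hplus t ht.1 ht.2.1 ht.2.2).1
  have hG2 : Tendsto (fun t : ℝ => G (p - t • c)) (𝓝[>] 0) (𝓝 (G p)) := by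
    refine (hGc p hpR hpv).tendsto.comp (tendsto_nhdsWithin_iff.2 ⟨?_, ?_⟩)
    · simpa [sub_eq_add_neg] using hlim (-c)
    filter_upwards [hsmall] with t ht using (hminus t ht.1 ht.2.1 ht.2.2).1
  obtain ⟨t, hne, ht, h1, h2⟩ := ((eventually_subtendedAngle_add_ne hpo hli hG1 hG2).and hsmall).exists
  exact hne (hconst ((hplus t ht h1 h2).2.trans (hj.trans (hminus t ht h1 h2).2.symm)))

/-! ### The part cut off by a closed set -/

/-- The part of `R` that is cut off by `C` from the point `x`. -/
def cutOff (R C : Set Plane) (x : Plane) : Set Plane :=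
  {y ∈ R | ¬ JoinedIn (R \ C) y x}

section cutOff

variable {R C : Set Plane} {x : Plane}

theorem mem_cutOff_iff_of_joinedIn {y z : Plane} (h : JoinedIn (R \ C) y z) :
    y ∈ cutOff R C x ↔ z ∈ cutOff R C x :=
  ⟨fun hy => ⟨h.target_mem.1, fun hz => hy.2 (h.trans hz)⟩,
    fun hz => ⟨h.source_mem.1, fun hy => hz.2 (h.symm.trans hy)⟩⟩

theorem subset_cutOff (hC : C ⊆ R) : C ⊆ cutOff R C x :=
  fun _ hy => ⟨hC hy, fun h => h.source_mem.2 hy⟩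

theorem eventually_joinedIn (hC : IsClosed C)
    (hstar : ∀ x ∈ R, ∃ r > 0, ∀ y ∈ Metric.ball x r, y ∈ R → segment ℝ x y ⊆ R)
    {z : Plane} (hz : z ∈ R) (hzC : z ∉ C) :
    ∀ᶠ y in 𝓝 z, y ∈ R → JoinedIn (R \ C) y z := by
  obtain ⟨r, hr, hst⟩ := hstar z hz
  obtain ⟨r', hr', hC'⟩ := Metric.mem_nhds_iff.1 (hC.isOpen_compl.mem_nhds hzC)
  filter_upwards [Metric.ball_mem_nhds z hr, Metric.ball_mem_nhds z hr'] with y h1 h2 hy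
  have hseg : segment ℝ z y ⊆ R \ C := fun w hw => ⟨hst y h1 hy hw,
    hC' ((convex_ball z r').segment_subset (Metric.mem_ball_self hr') h2 hw)⟩
  exact (joinedIn_of_segment_subset hseg).symm

theorem eventually_mem_cutOff (hC : IsClosed C)
    (hstar : ∀ x ∈ R, ∃ r > 0, ∀ y ∈ Metric.ball x r, y ∈ R → segment ℝ x y ⊆ R)
    {z : Plane} (hz : z ∈ cutOff R C x) (hzC : z ∉ C) :
    ∀ᶠ y in 𝓝 z, y ∈ R → y ∈ cutOff R C x := by
  filter_upwards [eventually_joinedIn hC hstar hz.1 hzC] with y h hy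
  exact (mem_cutOff_iff_of_joinedIn (h hy)).2 hz

/-- By local star-shapedness, the points joined to `x` off `C` form a relatively open subset of `R`;
the cut-off part is its complement in `R`. -/
theorem isCompact_cutOff (hR : IsCompact R) (hC : IsClosed C)
    (hstar : ∀ x ∈ R, ∃ r > 0, ∀ y ∈ Metric.ball x r, y ∈ R → segment ℝ x y ⊆ R) :
    IsCompact (cutOff R C x) := by
  refine hR.of_isClosed_subset ?_ fun y hy => hy.1
  rw [← isOpen_compl_iff, isOpen_iff_mem_nhds]
  intro z hz
  by_cases hzR : z ∈ R
  · have hj : JoinedIn (R \ C) z x := by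
      by_contra hj
      exact hz ⟨hzR, hj⟩
    filter_upwards [eventually_joinedIn hC hstar hzR hj.source_mem.2] with y h hy
    exact hy.2 ((h hy.1).trans hj)
  · filter_upwards [hR.isClosed.isOpen_compl.mem_nhds hzR] with y hy h using hy h.1

/-- Every point of the part cut off by `C` is joined to `C` within that part. -/
theorem exists_joinedIn_cutOff (hC : IsClosed C) (hCR : C ⊆ R) {y v : Plane} (hv : v ∈ C)
    (hy : y ∈ cutOff R C x) (hj : JoinedIn R y v) : ∃ w ∈ C, JoinedIn (cutOff R C x) y w := by
  set γ := hj.somePath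
  have hcl : IsClosed {t | γ t ∈ C} := hC.preimage γ.continuous
  -- `t₀` is the first time at which the path meets `C`; before it the path does not leave the
  -- cut-off part.
  obtain ⟨t₀, ht₀, hmin⟩ := hcl.isCompact.exists_isLeast ⟨1, by simpa [γ] using hv⟩
  refine ⟨γ t₀, ht₀, ?_⟩
  have hsub : ∀ {F : Set Plane} (t : unitInterval), (∀ u ≤ t, γ u ∈ F) → JoinedIn F y (γ t) := by
    intro F t ht
    refine ⟨(γ.subpath 0 t).cast γ.source.symm rfl, fun s => ?_⟩
    have hs : (γ.subpath 0 t) s ∈ γ '' Icc 0 t := by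
      rw [← γ.range_subpath_of_le 0 t t.2.1]
      exact mem_range_self s
    obtain ⟨u, hu, hus⟩ := hs
    simp only [Path.cast_coe]
    rw [← hus]
    exact ht u hu.2
  refine hsub t₀ fun t ht => ?_
  rcases ht.eq_or_lt with rfl | hlt
  · exact subset_cutOff hCR ht₀
  · refine (mem_cutOff_iff_of_joinedIn (hsub t fun u hu => ⟨hj.somePath_mem u, fun huC => ?_⟩)).1 hy
    exact absurd (hmin huC) (not_le.2 (hu.trans_lt hlt))

end cutOff

/-! ### The choice of the chord -/

namespace IsReflexCorner

variable {R : Set Plane} {v a b x : Plane} {e : ℝ}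

/-- Being joined in the complement of a chord is an open condition on the direction of the chord. -/
theorem eventually_joinedIn_compl_chord (h : IsReflexCorner R v a b e) (hR : IsCompact R)
    {y : Plane} {θ₀ : ℝ} (hθ₀ : θ₀ ∈ Icc (0 : ℝ) 1)
    (hj : JoinedIn (R \ chord R v (-((1 - θ₀) • a + θ₀ • b))) y x) :
    ∀ᶠ θ in 𝓝[Icc 0 1] θ₀, JoinedIn (R \ chord R v (-((1 - θ) • a + θ • b))) y x := by
  obtain ⟨f, hfa, hfb⟩ := h.exists_height
  set Γ := range hj.somePath with hΓ
  have hΓc : IsCompact Γ := isCompact_range hj.somePath.continuous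
  have hΓR : ∀ z ∈ Γ, z ∈ R ∧ z ∉ chord R v (-((1 - θ₀) • a + θ₀ • b)) := by
    rintro _ ⟨t, rfl⟩
    exact hj.somePath_mem t
  -- `Z` pairs a direction `θ` with a point of the path on the chord of that direction. Expressing
  -- the ray parameter by `f` makes `Z` compact, so its projection, the set of bad directions, is
  -- closed.
  set Z : Set (ℝ × Plane) := ((Icc 0 1 ×ˢ Γ) ∩ {p | segment ℝ v p.2 ⊆ R}) ∩
    ({p | p.2 = v + (-f (p.2 - v)) • (-((1 - p.1) • a + p.1 • b))} ∩ {p | 0 ≤ -f (p.2 - v)}) with hZ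
  have hZc : IsCompact Z := by
    refine ((isCompact_Icc.prod hΓc).inter_right
      (isClosed_visible hR.isClosed continuous_snd)).inter_right (IsClosed.inter ?_ ?_)
    · exact isClosed_eq (by fun_prop) (by fun_prop)
    · exact isClosed_le (by fun_prop) (by fun_prop)
  have hopen : (Prod.fst '' Z)ᶜ ∈ 𝓝 θ₀ := by
    refine (hZc.image continuous_fst).isClosed.isOpen_compl.mem_nhds ?_
    rintro ⟨⟨θ, z⟩, ⟨⟨⟨-, hzΓ⟩, hz⟩, hz1, hz2⟩, rfl⟩
    exact (hΓR z hzΓ).2 ⟨hz, _, hz2, hz1⟩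
  filter_upwards [nhdsWithin_le_nhds hopen, self_mem_nhdsWithin] with θ hθ hθI
  refine ⟨hj.somePath, fun t => ⟨(hj.somePath_mem t).1, fun hch => hθ ?_⟩⟩
  refine ⟨(θ, hj.somePath t), ⟨⟨⟨hθI, mem_range_self t⟩, hch.1⟩, ?_⟩, rfl⟩
  obtain ⟨-, r, hr, hre⟩ := hch
  have hf : -f (hj.somePath t - v) = r := by
    rw [hre, add_sub_cancel_left]
    simp [hfa, hfb]
    ring
  simp only [mem_inter_iff, mem_ofPred_eq, hf]
  exact ⟨hre, hr⟩

theorem tendsto_coords (v a b : Plane) (p q : ℝ) :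
    Tendsto (fun t : ℝ => v + (t * p) • a + (t * q) • b) (𝓝[>] 0) (𝓝 v) := by
  have : ContinuousAt (fun t : ℝ => v + (t * p) • a + (t * q) • b) 0 := by fun_prop
  simp only [ContinuousAt, zero_mul, zero_smul, add_zero] at this
  exact this.mono_left nhdsWithin_le_nhds

/-- If the edge along `a` is cut off by its own extension, then the apex is flat. -/
theorem isFlatAt_of_extension (h : IsReflexCorner R v a b e)
    (hstar : ∀ x ∈ R, ∃ r > 0, ∀ y ∈ Metric.ball x r, y ∈ R → segment ℝ x y ⊆ R)
    (hC : IsClosed (chord R v (-((1 : ℝ) • a + (0 : ℝ) • b))))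
    (hj : ¬ JoinedIn (R \ chord R v (-((1 : ℝ) • a + (0 : ℝ) • b))) (v + (e / 2) • a) x) :
    IsFlatAt (cutOff R (chord R v (-((1 : ℝ) • a + (0 : ℝ) • b))) x) v ∧
      v ∈ closure (interior (cutOff R (chord R v (-((1 : ℝ) • a + (0 : ℝ) • b))) x)) := by
  set C := chord R v (-((1 : ℝ) • a + (0 : ℝ) • b)) with hCdef
  have he := h.pos
  have hz : ∀ {z}, JoinedIn (R \ C) z (v + (e / 2) • a) → z ∈ cutOff R C x := fun hzj =>
    ⟨hzj.source_mem.1, fun hzx => hj (hzj.symm.trans hzx)⟩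
  constructor
  · refine ⟨a, by simpa using h.linearIndependent.ne_zero 0, ?_⟩
    filter_upwards [Metric.ball_mem_nhds (0 : ℝ) he] with t ht
    have ht : |t| < e := by simpa using ht
    -- The segment around `v` consists of a piece of the chord and a piece of the edge that it
    -- extends.
    rcases le_or_gt t 0 with ht0 | ht0
    · refine subset_cutOff (chord_subset _ _ _) ?_
      have := h.mem_chord (α := 1) (β := 0) (r := -t) zero_le_one le_rfl (by linarith)
        (by linarith [(abs_lt.1 ht).1]) (by simpa using he)
      convert this using 1
      module
    · have h0 : |(0 : ℝ)| < e := by simpa using he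
      have := h.joinedIn_left zero_le_one le_rfl ht h0 ((h.mem_iff _ _ ht h0).2 (by simp))
        (Or.inr ⟨ht0, rfl, rfl⟩)
      have e0 : v + t • a = v + t • a + (0 : ℝ) • b := by rw [zero_smul, add_zero]
      rw [e0]
      exact hz this
  · refine mem_closure_of_tendsto (tendsto_coords v a b 1 (-1)) ?_
    filter_upwards [Ioo_mem_nhdsGT he] with t ht
    have h1 : |t * 1| < e := by rw [mul_one, abs_of_pos ht.1]; exact ht.2
    have h2 : |t * -1| < e := by rw [mul_neg_one, abs_neg, abs_of_pos ht.1]; exact ht.2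
    have hint := h.mem_interior h1 h2 (Or.inr (by linarith [ht.1]))
    have hjt := h.joinedIn_left zero_le_one le_rfl h1 h2 (interior_subset hint)
      (Or.inl (by nlinarith [ht.1]))
    rw [mem_interior_iff_mem_nhds] at hint ⊢
    filter_upwards [hint, eventually_mem_cutOff hC hstar (hz hjt) hjt.source_mem.2] with y h3 h4
      using h4 h3

/-- Near the apex, every point off the chord is joined to one of the edges. So a whole neighbourhood
of `v` in `R` is cut off, and `R` is flat at `v` along `a`. -/
theorem isFlatAt_of_not_joinedIn (h : IsReflexCorner R v a b e) {α β : ℝ} (hα : 0 ≤ α)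
    (hβ : 0 ≤ β) (hαβ : 0 < α ^ 2 + β ^ 2)
    (hja : ¬ JoinedIn (R \ chord R v (-(α • a + β • b))) (v + (e / 2) • a) x)
    (hjb : ¬ JoinedIn (R \ chord R v (-(α • a + β • b))) (v + (e / 2) • b) x) :
    IsFlatAt (cutOff R (chord R v (-(α • a + β • b))) x) v ∧
      v ∈ closure (interior (cutOff R (chord R v (-(α • a + β • b))) x)) := by
  set C := chord R v (-(α • a + β • b)) with hCdef
  have he := h.pos
  have hnear : ∀ᶠ y in 𝓝 v, y ∈ R → y ∈ cutOff R C x := by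
    filter_upwards [h.eventually_coords v he]
    rintro _ ⟨s, t, hs, ht, rfl⟩ hyR
    by_cases hyC : v + s • a + t • b ∈ C
    · exact subset_cutOff (chord_subset _ _ _) hyC
    · refine ⟨hyR, fun hyx => ?_⟩
      rcases h.joinedIn_or hα hβ hαβ hs ht hyR hyC with h1 | h1
      · exact hja (h1.symm.trans hyx)
      · exact hjb (h1.symm.trans hyx)
  constructor
  · refine IsFlatAt.congr (K := R) ⟨a, by simpa using h.linearIndependent.ne_zero 0, ?_⟩ hnear
    filter_upwards [Metric.ball_mem_nhds (0 : ℝ) he] with t ht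
    have := (h.mem_iff t 0 (by simpa using ht) (by simpa using he)).2 (by simp)
    simpa using this
  · refine mem_closure_of_tendsto (tendsto_coords v a b (-1) (-1)) ?_
    filter_upwards [Ioo_mem_nhdsGT he,
      (tendsto_coords v a b (-1) (-1)).eventually hnear.eventually_nhds] with t ht hev
    have h2 : |t * -1| < e := by rw [mul_neg_one, abs_neg, abs_of_pos ht.1]; exact ht.2
    have hint := h.mem_interior h2 h2 (Or.inr (by linarith [ht.1]))
    rw [mem_interior_iff_mem_nhds] at hint ⊢
    filter_upwards [hint, hev] with y h3 h4 using h4 h3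

/-- From a reflex corner there is a chord such that the part cut off from a given point `x` contains
a segment around the corner. -/
theorem exists_chord (h : IsReflexCorner R v a b e) (hR : IsCompact R) (hc : IsPreconnected Rᶜ)
    (hstar : ∀ x ∈ R, ∃ r > 0, ∀ y ∈ Metric.ball x r, y ∈ R → segment ℝ x y ⊆ R) :
    ∃ α β : ℝ, 0 ≤ α ∧ 0 ≤ β ∧ 0 < α ^ 2 + β ^ 2 ∧
      IsFlatAt (cutOff R (chord R v (-(α • a + β • b))) x) v ∧
      v ∈ closure (interior (cutOff R (chord R v (-(α • a + β • b))) x)) := by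
  have hclosed : ∀ {α β : ℝ}, 0 < α ^ 2 + β ^ 2 → IsClosed (chord R v (-(α • a + β • b))) := by
    intro α β hαβ
    obtain ⟨T, -, hT, -⟩ := exists_chord_end hR hstar h.apex_mem (h.direction_ne_zero hαβ)
    rw [hT]
    exact (isCompact_segment _ _).isClosed
  have hpos : ∀ θ : ℝ, 0 < (1 - θ) ^ 2 + θ ^ 2 := fun θ => by nlinarith [sq_nonneg (2 * θ - 1)]
  set A : ℝ → Prop := fun θ =>
    JoinedIn (R \ chord R v (-((1 - θ) • a + θ • b))) (v + (e / 2) • a) x with hA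
  set B : ℝ → Prop := fun θ =>
    JoinedIn (R \ chord R v (-((1 - θ) • a + θ • b))) (v + (e / 2) • b) x with hB
  -- For `θ = 0` the chord extends the edge along `a`, for `θ = 1` the edge along `b`. If such an
  -- edge is cut off from `x`, the extension is the chord sought.
  by_cases hA0 : A 0
  swap
  · simp only [hA, sub_zero] at hA0
    exact ⟨1, 0, zero_le_one, le_rfl, by norm_num,
      h.isFlatAt_of_extension hstar (hclosed (by norm_num)) hA0⟩
  by_cases hB1 : B 1
  swap
  · simp only [hB, sub_self] at hB1
    have hcomm : (0 : ℝ) • a + (1 : ℝ) • b = (1 : ℝ) • b + (0 : ℝ) • a := add_comm _ _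
    refine ⟨0, 1, le_rfl, zero_le_one, by norm_num, ?_⟩
    have hcl := hclosed (α := 0) (β := 1) (by norm_num)
    rw [hcomm] at hB1 hcl ⊢
    exact h.symm.isFlatAt_of_extension hstar hcl hB1
  have hdisj : ∀ θ ∈ Icc (0 : ℝ) 1, A θ → ¬ B θ := fun θ hθ h1 h2 =>
    h.not_joinedIn hR hc hstar (by linarith [hθ.2]) hθ.1 (hpos θ) (h1.trans h2.symm)
  by_contra hno
  have hcover : ∀ θ ∈ Icc (0 : ℝ) 1, ¬ A θ → B θ := by
    intro θ hθ h1
    by_contra h2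
    exact hno ⟨1 - θ, θ, by linarith [hθ.2], hθ.1, hpos θ,
      h.isFlatAt_of_not_joinedIn (by linarith [hθ.2]) hθ.1 (hpos θ) h1 h2⟩
  -- If no chord cut off both edges, the relatively open and disjoint conditions `A` and `B` would
  -- cover the interval, so `A` would be constant, against `A 0` and `B 1`.
  have hiff : A 0 ↔ A 1 := by
    refine (isPreconnected_Icc (a := (0 : ℝ)) (b := 1)).induction₂ (fun θ θ' => (A θ ↔ A θ')) ?_
      (fun _ _ _ _ _ _ h1 h2 => h1.trans h2) (fun _ _ _ _ h1 => h1.symm) (by simp) (by simp)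
    intro θ hθ
    by_cases h1 : A θ
    · filter_upwards [h.eventually_joinedIn_compl_chord hR hθ h1] with θ' h2
        using iff_of_true h1 h2
    · filter_upwards [h.eventually_joinedIn_compl_chord hR hθ (hcover θ hθ h1),
        self_mem_nhdsWithin] with θ' h2 hθ' using iff_of_false h1 fun h3 => hdisj θ' hθ' h3 h2
  exact hdisj 1 (by simp) (hiff.1 hA0) hB1

end IsReflexCorner

/-! ### Cuts and the two non-flat points behind each -/

/-- `K` is the part of `R` cut off from `x` by the closed subset `T` of `S`, where `T` contains the
apex `v`; the only point of `T` around which `K` may fail to contain a segment is `q`. -/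
structure IsCut (R S : Set Plane) (v x : Plane) (T K : Set Plane) (q : Plane) : Prop where
  subset : T ⊆ S
  apex_mem : v ∈ T
  isCompact : IsCompact K
  subset_region : K ⊆ R
  chord_subset : T ⊆ K
  mem_iff_of_joinedIn : ∀ y z, JoinedIn (R \ T) y z → (y ∈ K ↔ z ∈ K)
  joinedIn : ∀ y ∈ K, JoinedIn K y v
  notMem : x ∉ K
  isFlatAt : ∀ y ∈ T, y ≠ q → IsFlatAt K y
  mem_closure_interior : v ∈ closure (interior K)
  eventually_mem : ∀ z ∈ K, z ∉ T → ∀ᶠ y in 𝓝 z, y ∈ R → y ∈ K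

/-- The apex is flat by the choice of the chord, and the inner points of the chord are flat because
the chord lies in `K`. Only the far end of the chord remains as `q`. -/
theorem Polygon.IsSimple.exists_isCut {n : ℕ} {P : Polygon Plane n} (h : P.IsSimple)
    {i : Fin n} (hr : P.IsReflex i) {x : Plane} (hx : x ∈ P.region) (hxS : x ∉ P.starRegion i) :
    ∃ T K q, IsCut P.region (P.starRegion i) (P i) x T K q := by
  have hR := P.isCompact_region
  have hstar : ∀ x ∈ P.region, ∃ r > 0, ∀ y ∈ Metric.ball x r, y ∈ P.region →
      segment ℝ x y ⊆ P.region := fun x hx => P.exists_ball_segment_subset hx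
  obtain ⟨e, hcor⟩ := h.exists_isReflexCorner hr
  obtain ⟨α, β, hα, hβ, hαβ, hflat, hint⟩ :=
    hcor.exists_chord (x := x) hR P.isPreconnected_compl_region hstar
  set d := -(α • P.toPrev i + β • P.toNext i) with hd
  have hd0 : d ≠ 0 := hcor.direction_ne_zero hαβ
  obtain ⟨t, ht0, hch, -⟩ := exists_chord_end hR hstar hcor.apex_mem hd0
  set T := chord P.region (P i) d with hT
  have hTR : T ⊆ P.region := chord_subset _ _ _
  have hTc : IsClosed T := by rw [hch]; exact (isCompact_segment _ _).isClosed
  have hvT : P i ∈ T := by rw [hch]; exact left_mem_segment ℝ _ _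
  have hTS : T ⊆ P.starRegion i := by
    rintro _ ⟨hseg, r, hr, rfl⟩
    refine ⟨hseg (right_mem_segment ℝ _ _), hseg, r * α, r * β, by positivity, by positivity, ?_⟩
    rw [hd]; module
  refine ⟨T, cutOff P.region T x, P i + t • d, hTS, hvT, isCompact_cutOff hR hTc hstar,
    fun y hy => hy.1, subset_cutOff hTR, fun y z => mem_cutOff_iff_of_joinedIn, ?_, ?_, ?_, hint,
    fun z => eventually_mem_cutOff hTc hstar⟩
  · intro y hy
    obtain ⟨w, hw, hyw⟩ := exists_joinedIn_cutOff hTc hTR hvT hy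
      (P.joinedIn_region hy.1 hcor.apex_mem)
    refine hyw.trans (joinedIn_of_segment_subset (subset_trans ?_ (subset_cutOff hTR)))
    rw [hch] at hw ⊢
    exact (convex_segment _ _).segment_subset hw (left_mem_segment ℝ _ _)
  · exact fun hxK => hxK.2 (JoinedIn.refl ⟨hx, fun hxT => hxS (hTS hxT)⟩)
  · intro y hy hyq
    by_cases hyv : y = P i
    · rw [hyv]; exact hflat
    · rw [hch] at hy
      have hne : P i ≠ P i + t • d := by
        intro heq
        rw [← heq, segment_same] at hy
        exact hyv hy
      refine isFlatAt_of_mem_openSegment hne ?_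
        (mem_openSegment_of_ne_left_right (Ne.symm hyv) (Ne.symm hyq) hy)
      rw [← hch]
      exact subset_cutOff hTR

/-- `K` has a non-flat point other than `q`, and another one other than `q` and the first. They lie
off `T`, where `K` and `R` agree locally, so `R` is not flat there either. -/
theorem IsCut.exists_two {R S T K : Set Plane} {v x q : Plane} (h : IsCut R S v x T K q) :
    ∃ s : Finset Plane, s.card = 2 ∧ (∀ y ∈ s, y ∈ K ∧ ¬ IsFlatAt R y) := by
  have hint : (interior K).Nonempty := closure_nonempty_iff.1 ⟨v, h.mem_closure_interior⟩
  have key : ∀ y ∈ K, ¬ IsFlatAt K y → y ≠ q → ¬ IsFlatAt R y := by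
    intro y hy hf hq hR
    have hyT : y ∉ T := fun hyT => hf (h.isFlatAt y hyT hq)
    exact hf (hR.congr (h.eventually_mem y hy hyT))
  obtain ⟨y, hy, hyf, hyq, -⟩ := exists_not_isFlatAt h.isCompact hint q q
  obtain ⟨z, hz, hzf, hzq, hzy⟩ := exists_not_isFlatAt h.isCompact hint q y
  refine ⟨{y, z}, Finset.card_pair hzy.symm, ?_⟩
  intro w hw
  rw [Finset.mem_insert, Finset.mem_singleton] at hw
  rcases hw with rfl | rfl
  · exact ⟨hy, key _ hy hyf hyq⟩
  · exact ⟨hz, key _ hz hzf hzq⟩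

/-! ### Combinatorics of the cut-off parts -/

/-- Pairwise disjoint star-shaped sets `S i` with apices `v i`, and for `i ≠ j` a chord `T i j` in
`S i` that cuts off `K i j` from `v j`. -/
structure CutSystem {ι : Type*} (R : Set Plane) (S : ι → Set Plane) (v : ι → Plane)
    (T K : ι → ι → Set Plane) (q : ι → ι → Plane) : Prop where
  subset : ∀ i, S i ⊆ R
  joinedIn : ∀ i, ∀ y ∈ S i, JoinedIn (S i) (v i) y
  disjoint : ∀ i j, i ≠ j → Disjoint (S i) (S j)
  isCut : ∀ i j, i ≠ j → IsCut R (S i) (v i) (v j) (T i j) (K i j) (q i j)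

namespace CutSystem

variable {ι : Type*} {R : Set Plane} {S : ι → Set Plane} {v : ι → Plane}
  {T K : ι → ι → Set Plane} {q : ι → ι → Plane}

theorem star_subset_diff (h : CutSystem R S v T K q) {i k l : ι} (hkl : k ≠ l) (hik : i ≠ k) :
    S i ⊆ R \ T k l := fun _ hy =>
  ⟨h.subset i hy, fun hyT => disjoint_left.1 (h.disjoint i k hik) hy ((h.isCut k l hkl).subset hyT)⟩

theorem mem_iff_apex_mem (h : CutSystem R S v T K q) {i k l : ι} (hkl : k ≠ l) (hik : i ≠ k)
    {y : Plane} (hy : y ∈ S i) : y ∈ K k l ↔ v i ∈ K k l :=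
  ((h.isCut k l hkl).mem_iff_of_joinedIn _ _
    ((h.joinedIn i y hy).mono (h.star_subset_diff hkl hik))).symm

/-- If `v i` is not in `K k l`, the star `S i` and with it the chord `T i j` miss `K k l`. As `K k
l` is joined to `v k` within itself, it lies on one side of `T i j`. Nesting and disjointness of the
parts follow from this. -/
theorem mem_iff_of_mem (h : CutSystem R S v T K q) {i j k l : ι} (hij : i ≠ j) (hkl : k ≠ l)
    (hik : i ≠ k) (hi : v i ∉ K k l) {y : Plane} (hy : y ∈ K k l) :
    y ∈ K i j ↔ v k ∈ K i j := by
  refine (h.isCut i j hij).mem_iff_of_joinedIn _ _ (((h.isCut k l hkl).joinedIn y hy).mono ?_)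
  intro z hz
  refine ⟨(h.isCut k l hkl).subset_region hz, fun hzT => hi ?_⟩
  exact (h.mem_iff_apex_mem hkl hik ((h.isCut i j hij).subset hzT)).1 hz

theorem subset_of_mem (h : CutSystem R S v T K q) {i j k l : ι} (hij : i ≠ j) (hkl : k ≠ l)
    (hik : i ≠ k) (hi : v i ∉ K k l) (hk : v k ∈ K i j) : K k l ⊆ K i j :=
  fun _ hy => (h.mem_iff_of_mem hij hkl hik hi hy).2 hk

theorem disjoint_of_notMem (h : CutSystem R S v T K q) {i j k l : ι} (hij : i ≠ j) (hkl : k ≠ l)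
    (hik : i ≠ k) (hi : v i ∉ K k l) (hk : v k ∉ K i j) : Disjoint (K k l) (K i j) :=
  disjoint_left.2 fun _ hy hy' => hk ((h.mem_iff_of_mem hij hkl hik hi hy).1 hy')

theorem disjoint_swap (h : CutSystem R S v T K q) {i j : ι} (hij : i ≠ j) :
    Disjoint (K i j) (K j i) :=
  h.disjoint_of_notMem hij.symm hij hij.symm (h.isCut i j hij).notMem (h.isCut j i hij.symm).notMem

theorem apex_mem (h : CutSystem R S v T K q) {i j : ι} (hij : i ≠ j) : v i ∈ K i j :=
  (h.isCut i j hij).chord_subset (h.isCut i j hij).apex_mem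

/-- Every part that is cut off contains one with a single apex. -/
theorem exists_leaf [Finite ι] (h : CutSystem R S v T K q) (i j : ι) (hij : i ≠ j) :
    ∃ k l, k ≠ l ∧ (∀ m, v m ∈ K k l → m = k) ∧ K k l ⊆ K i j := by
  induction hN : {m | v m ∈ K i j}.ncard using Nat.strong_induction_on generalizing i j with
  | _ N ih =>
    by_cases hleaf : ∀ m, v m ∈ K i j → m = i
    · exact ⟨i, j, hij, hleaf, subset_rfl⟩
    -- For another apex `v k` in `K i j`, the part `K k i` lies in `K i j` and loses the apex `v i`,
    -- so the number of apices drops.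
    · push Not at hleaf
      obtain ⟨k, hk, hki⟩ := hleaf
      have hi := (h.isCut k i hki).notMem
      have hsub := h.subset_of_mem hij hki hki.symm hi hk
      have hlt : {m | v m ∈ K k i}.ncard < N := by
        rw [← hN]
        refine Set.ncard_lt_ncard ⟨fun m hm => hsub hm, fun hsup => hi (hsup ?_)⟩ (Set.toFinite _)
        exact h.apex_mem hij
      obtain ⟨a, b, hab, hl, hs⟩ := ih _ hlt k i hki rfl
      exact ⟨a, b, hab, hl, hs.trans hsub⟩

theorem exists_four_le_card (h : CutSystem R S v T K q) {i j : ι} (hij : i ≠ j) :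
    ∃ s : Finset Plane, 4 ≤ s.card ∧ ∀ y ∈ s, y ∈ R ∧ ¬ IsFlatAt R y := by
  classical
  obtain ⟨s, hs, hs'⟩ := (h.isCut i j hij).exists_two
  obtain ⟨t, ht, ht'⟩ := (h.isCut j i hij.symm).exists_two
  have hd : Disjoint s t := Finset.disjoint_left.2 fun y h1 h2 =>
    disjoint_left.1 (h.disjoint_swap hij) (hs' y h1).1 (ht' y h2).1
  refine ⟨s ∪ t, by rw [Finset.card_union_of_disjoint hd]; omega, fun y hy => ?_⟩
  rcases Finset.mem_union.1 hy with hy | hy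
  · exact ⟨(h.isCut i j hij).subset_region (hs' y hy).1, (hs' y hy).2⟩
  · exact ⟨(h.isCut j i hij.symm).subset_region (ht' y hy).1, (ht' y hy).2⟩

/-- The part between two chords contains a point around which the region contains no segment. -/
theorem exists_between (h : CutSystem R S v T K q) {a b i j : ι} (hia : i ≠ a) (hjb : j ≠ b)
    (hij : i ≠ j) (hi : v i ∈ K j b) (hj : v j ∈ K i a) :
    ∃ y ∈ K i a ∩ K j b, ¬ IsFlatAt R y := by
  have hA := h.isCut i a hia
  have hB := h.isCut j b hjb
  have hSi : S i ⊆ K j b := fun y hy => (h.mem_iff_apex_mem hjb hij hy).2 hi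
  have hSj : S j ⊆ K i a := fun y hy => (h.mem_iff_apex_mem hia hij.symm hy).2 hj
  have hnT : ∀ y ∈ S i, y ∉ T j b := fun y hy hyT =>
    disjoint_left.1 (h.disjoint i j hij) hy (hB.subset hyT)
  have hnT' : ∀ y ∈ S j, y ∉ T i a := fun y hy hyT =>
    disjoint_left.1 (h.disjoint i j hij) (hA.subset hyT) hy
  have hint : (interior (K i a ∩ K j b)).Nonempty := by
    have hvS : v i ∈ S i := hA.subset hA.apex_mem
    have hev := (hB.eventually_mem (v i) hi (hnT _ hvS)).eventually_nhds
    obtain ⟨y, hy, hyK⟩ := (mem_closure_iff_frequently.1 hA.mem_closure_interior).and_eventually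
      hev |>.exists
    refine ⟨y, ?_⟩
    rw [mem_interior_iff_mem_nhds] at hy ⊢
    filter_upwards [hy, hyK] with z h1 h2 using ⟨h1, h2 (hA.subset_region h1)⟩
  -- The intersection may fail to be flat at both chord ends, so two points have to be avoided.
  obtain ⟨y, ⟨hyA, hyB⟩, hf, hq1, hq2⟩ := exists_not_isFlatAt
    (hA.isCompact.inter_right hB.isCompact.isClosed) hint (q i a) (q j b)
  have hyTA : y ∉ T i a := by
    intro hyT
    -- Near a point of the chord `T i a`, which is disjoint from `T j b`, the set `K j b` fills all
    -- of `R`, so flatness passes from `K i a` to the intersection.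
    refine hf ((hA.isFlatAt y hyT hq1).congr ?_)
    filter_upwards [hB.eventually_mem y hyB (hnT y (hA.subset hyT))] with z h1 h2
    exact ⟨h2, h1 (hA.subset_region h2)⟩
  have hyTB : y ∉ T j b := by
    intro hyT
    refine hf ((hB.isFlatAt y hyT hq2).congr ?_)
    filter_upwards [hA.eventually_mem y hyA hyTA] with z h1 h2
    exact ⟨h1 (hB.subset_region h2), h2⟩
  refine ⟨y, ⟨hyA, hyB⟩, fun hfR => hf (hfR.congr ?_)⟩
  filter_upwards [hA.eventually_mem y hyA hyTA, hB.eventually_mem y hyB hyTB] with z h1 h2 h3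
    using ⟨h1 h3, h2 h3⟩

/-- Leaves inside `K i j` and `K j i` give four points. The fifth lies in a leaf at a third apex or,
if there is none, between the chords of two inner stars. -/
theorem exists_five_le_card [Fintype ι] (h : CutSystem R S v T K q) (hι : 4 ≤ Fintype.card ι) :
    ∃ s : Finset Plane, 5 ≤ s.card ∧ ∀ y ∈ s, y ∈ R ∧ ¬ IsFlatAt R y := by
  classical
  obtain ⟨i, j, hij⟩ := Fintype.exists_pair_of_one_lt_card (α := ι) (by omega)
  obtain ⟨a, a', haa', hla, hsa⟩ := h.exists_leaf i j hij
  obtain ⟨b, b', hbb', hlb, hsb⟩ := h.exists_leaf j i hij.symm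
  have hKab : Disjoint (K a a') (K b b') := (h.disjoint_swap hij).mono hsa hsb
  have hab : a ≠ b := by
    rintro rfl
    exact disjoint_left.1 hKab (h.apex_mem haa') (h.apex_mem hbb')
  obtain ⟨s, hs, hs'⟩ := (h.isCut a a' haa').exists_two
  obtain ⟨t, ht, ht'⟩ := (h.isCut b b' hbb').exists_two
  have hst : Disjoint s t := Finset.disjoint_left.2 fun y h1 h2 =>
    disjoint_left.1 hKab (hs' y h1).1 (ht' y h2).1
  -- it remains to find one more point, off `K a a'` and `K b b'`
  suffices hy : ∃ y ∈ R, y ∉ K a a' ∧ y ∉ K b b' ∧ ¬ IsFlatAt R y by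
    obtain ⟨y, hyR, hya, hyb, hyf⟩ := hy
    have hyst : y ∉ s ∪ t := by
      rw [Finset.mem_union]
      rintro (hy | hy)
      · exact hya (hs' y hy).1
      · exact hyb (ht' y hy).1
    refine ⟨insert y (s ∪ t), ?_, fun z hz => ?_⟩
    · rw [Finset.card_insert_of_notMem hyst, Finset.card_union_of_disjoint hst]; omega
    · rw [Finset.mem_insert, Finset.mem_union] at hz
      rcases hz with rfl | hz | hz
      · exact ⟨hyR, hyf⟩
      · exact ⟨(h.isCut a a' haa').subset_region (hs' z hz).1, (hs' z hz).2⟩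
      · exact ⟨(h.isCut b b' hbb').subset_region (ht' z hz).1, (ht' z hz).2⟩
  have hleaf : ∀ {k l k' l'}, k ≠ l → k' ≠ l' → k ≠ k' → (∀ m, v m ∈ K k l → m = k) →
      (∀ m, v m ∈ K k' l' → m = k') → Disjoint (K k l) (K k' l') := by
    intro k l k' l' hkl hkl' hkk' h1 h2
    exact h.disjoint_of_notMem hkl' hkl hkk'.symm (fun h3 => hkk' (h1 _ h3).symm)
      (fun h3 => hkk' (h2 _ h3))
  by_cases hthird : ∃ c c', c ≠ c' ∧ c ≠ a ∧ c ≠ b ∧ ∀ m, v m ∈ K c c' → m = c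
  · obtain ⟨c, c', hcc', hca, hcb, hlc⟩ := hthird
    obtain ⟨u, hu, hu'⟩ := (h.isCut c c' hcc').exists_two
    obtain ⟨y, hy⟩ : u.Nonempty := Finset.card_pos.1 (by omega)
    have hyK := (hu' y hy).1
    exact ⟨y, (h.isCut c c' hcc').subset_region hyK,
      disjoint_left.1 (hleaf hcc' haa' hca hlc hla) hyK,
      disjoint_left.1 (hleaf hcc' hbb' hcb hlc hlb) hyK, (hu' y hy).2⟩
  -- Without a leaf at a third apex, the leaf inside any part has apex `v a` or `v b`.
  have hbase : ∀ k l, k ≠ l → v a ∈ K k l ∨ v b ∈ K k l := by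
    intro k l hkl
    obtain ⟨c, c', hcc', hlc, hsub⟩ := h.exists_leaf k l hkl
    have hc := hsub (h.apex_mem hcc')
    by_cases hca : c = a
    · exact Or.inl (hca ▸ hc)
    by_cases hcb : c = b
    · exact Or.inr (hcb ▸ hc)
    exact absurd ⟨c, c', hcc', hca, hcb, hlc⟩ hthird
  obtain ⟨p, r, hpr, hpa, hpb, hra, hrb⟩ :
      ∃ p r : ι, p ≠ r ∧ p ≠ a ∧ p ≠ b ∧ r ≠ a ∧ r ≠ b := by
    have hcard : 1 < (Finset.univ \ {a, b} : Finset ι).card := by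
      have h1 := Finset.le_card_sdiff ({a, b} : Finset ι) Finset.univ
      rw [Finset.card_pair hab, Finset.card_univ] at h1
      omega
    obtain ⟨p, hp, r, hr, hpr⟩ := Finset.one_lt_card.1 hcard
    simp only [Finset.mem_sdiff, Finset.mem_univ, true_and, Finset.mem_insert,
      Finset.mem_singleton, not_or] at hp hr
    exact ⟨p, r, hpr, hp.1, hp.2, hr.1, hr.2⟩
  -- name the two inner stars such that `p` is on the side of `a`
  wlog hp : v a ∈ K p r ∧ v b ∈ K r p generalizing p r
  · refine this r p hpr.symm hra hrb hpa hpb ?_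
    have hd := disjoint_left.1 (h.disjoint_swap hpr)
    rcases hbase p r hpr with h1 | h1 <;> rcases hbase r p hpr.symm with h2 | h2
    · exact absurd h2 (hd h1)
    · exact absurd ⟨h1, h2⟩ hp
    · exact ⟨h2, h1⟩
    · exact absurd h2 (hd h1)
  -- `K p a` misses `v a`, so it contains `v b`; likewise `K r b` contains `v a`. These two parts
  -- face each other, each containing the apex of the other.
  have hb1 : v b ∈ K p a := (hbase p a hpa).resolve_left (h.isCut p a hpa).notMem
  have ha1 : v a ∈ K r b := (hbase r b hrb).resolve_right (h.isCut r b hrb).notMem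
  have hpm : v p ∈ K r b := by
    by_contra hno
    exact disjoint_left.1 (h.disjoint_of_notMem hpr hrb hpr hno (h.isCut p r hpr).notMem) ha1 hp.1
  have hrm : v r ∈ K p a := by
    by_contra hno
    exact disjoint_left.1 (h.disjoint_of_notMem hpr.symm hpa hpr.symm hno
      (h.isCut r p hpr.symm).notMem) hb1 hp.2
  obtain ⟨y, ⟨hy1, hy2⟩, hyf⟩ := h.exists_between hpa hrb hpr hpm hrm
  refine ⟨y, (h.isCut p a hpa).subset_region hy1, fun hya => ?_, fun hyb => ?_, hyf⟩
  · exact disjoint_left.1 (h.disjoint_of_notMem hpa haa' hpa (fun h1 => hpa (hla _ h1))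
      (h.isCut p a hpa).notMem) hya hy1
  · exact disjoint_left.1 (h.disjoint_of_notMem hrb hbb' hrb (fun h1 => hrb (hlb _ h1))
      (h.isCut r b hrb).notMem) hyb hy2

end CutSystem

/-! ### Counting vertices -/

namespace Polygon

variable {n : ℕ} {P : Polygon Plane n}

theorem IsSimple.exists_cutSystem (h : P.IsSimple) {S : Finset (Fin n)}
    (hS : P.HasDisjointStarRegions S) : ∃ T K q,
      CutSystem P.region (fun i : S => P.starRegion i) (fun i : S => P i) T K q := by
  have hapex : ∀ i : S, P i ∈ P.region := fun i =>
    let ⟨_, hc⟩ := h.exists_isReflexCorner (hS.1 i i.2)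
    hc.apex_mem
  have hstar : ∀ i : S, P i ∈ P.starRegion i := fun i =>
    ⟨hapex i, by simpa using hapex i, 0, 0, le_rfl, le_rfl, by simp⟩
  have hdisj : ∀ i j : S, i ≠ j → Disjoint (P.starRegion i) (P.starRegion j) := fun i j hij =>
    disjoint_iff_inter_eq_empty.2 (hS.2 i i.2 j j.2 fun h => hij (Subtype.ext h))
  have hcut : ∀ i j : S, ∃ T K q, i ≠ j → IsCut P.region (P.starRegion i) (P i) (P j) T K q := by
    intro i j
    by_cases hij : i = j
    -- Arbitrary values on the diagonal, where no cut is required.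
    · exact ⟨∅, ∅, 0, fun h => absurd hij h⟩
    · obtain ⟨T, K, q, hc⟩ := h.exists_isCut (hS.1 i i.2) (hapex j)
        (disjoint_right.1 (hdisj i j hij) (hstar j))
      exact ⟨T, K, q, fun _ => hc⟩
  choose T K q hc using hcut
  refine ⟨T, K, q, fun i y hy => hy.1, fun i y hy => joinedIn_of_segment_subset ?_, hdisj, hc⟩
  obtain ⟨-, hseg, s, t, hs, ht, rfl⟩ := hy
  intro z hz
  refine ⟨hseg hz, ((convex_segment _ _).segment_subset (left_mem_segment ℝ _ _) hz).trans hseg, ?_⟩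
  rw [segment_eq_image'] at hz
  obtain ⟨m, ⟨hm, -⟩, rfl⟩ := hz
  exact ⟨m * s, m * t, by positivity, by positivity, by module⟩

/-- Non-flat points are vertices with non-reflex index, so they lie in the image of the complement
of `S`. -/
theorem IsSimple.card_add_le (h : P.IsSimple) {S : Finset (Fin n)}
    (hS : ∀ i ∈ S, P.IsReflex i) {s : Finset Plane}
    (hs : ∀ y ∈ s, y ∈ P.region ∧ ¬ IsFlatAt P.region y) : S.card + s.card ≤ n := by
  classical
  have hle : s.card ≤ Sᶜ.card := by
    refine le_trans (Finset.card_le_card fun y hy => ?_) (Finset.card_image_le (f := P))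
    obtain ⟨k, hk, hkr⟩ := h.exists_vertex_of_not_isFlatAt (hs y hy).1 (hs y hy).2
    exact Finset.mem_image.2 ⟨k, Finset.mem_compl.2 fun hkS => hkr (hS k hkS), hk⟩
  have := S.card_add_card_compl
  rw [Fintype.card_fin] at this
  omega

theorem IsSimple.card_add_four_le (h : P.IsSimple) {S : Finset (Fin n)}
    (hS : P.HasDisjointStarRegions S) (hc : 2 ≤ S.card) : S.card + 4 ≤ n := by
  obtain ⟨T, K, q, hsys⟩ := h.exists_cutSystem hS
  obtain ⟨i, hi, j, hj, hij⟩ := Finset.one_lt_card.1 hc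
  obtain ⟨s, hs, hs'⟩ := hsys.exists_four_le_card (i := ⟨i, hi⟩) (j := ⟨j, hj⟩)
    (by simpa using hij)
  have := h.card_add_le hS.1 hs'
  omega

theorem IsSimple.card_add_five_le (h : P.IsSimple) {S : Finset (Fin n)}
    (hS : P.HasDisjointStarRegions S) (hc : 4 ≤ S.card) : S.card + 5 ≤ n := by
  obtain ⟨T, K, q, hsys⟩ := h.exists_cutSystem hS
  obtain ⟨s, hs, hs'⟩ := hsys.exists_five_le_card (by simpa using hc)
  have := h.card_add_le hS.1 hs'
  omega

end Polygon

theorem mainTheorem2 :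
    (∀ (n : ℕ) (P : Polygon Plane n), P.IsSimple →
      (P.ContainsDisjointStarRegions 2 → 6 ≤ n) ∧
      (P.ContainsDisjointStarRegions 3 → 7 ≤ n) ∧
      (P.ContainsDisjointStarRegions 4 → 9 ≤ n) ∧
      (P.ContainsDisjointStarRegions 5 → 10 ≤ n)) ∧
    (∀ P : Polygon Plane 6, P.IsSimple →
      ∀ S : Finset (Fin 6), P.HasDisjointStarRegions S → S.card ≤ 2) ∧
    (∀ P : Polygon Plane 7, P.IsSimple →
      ∀ S : Finset (Fin 7), P.HasDisjointStarRegions S → S.card ≤ 3) ∧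
    (∀ P : Polygon Plane 8, P.IsSimple →
      ∀ S : Finset (Fin 8), P.HasDisjointStarRegions S → S.card ≤ 3) := by
  refine ⟨fun n P h => ⟨?_, ?_, ?_, ?_⟩, fun P h S hS => ?_, fun P h S hS => ?_, fun P h S hS => ?_⟩
  · rintro ⟨S, hc, hS⟩
    have := h.card_add_four_le hS (by omega)
    omega
  · rintro ⟨S, hc, hS⟩
    have := h.card_add_four_le hS (by omega)
    omega
  · rintro ⟨S, hc, hS⟩
    have := h.card_add_five_le hS (by omega)
    omega
  · rintro ⟨S, hc, hS⟩
    have := h.card_add_five_le hS (by omega)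
    omega
  · by_contra! hlt
    have := h.card_add_four_le hS (by omega)
    omega
  · by_contra! hlt
    have := h.card_add_five_le hS (by omega)
    omega
  · by_contra! hlt
    have := h.card_add_five_le hS (by omega)
    omega
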